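/- Let $f,g:\mathbb{C}\to\widehat{\mathbb{C}}$ be meromorphic functions in the plane, with $g$ non-constant. Suppose that $f$ and $g$ commute: for every $z\in\mathbb{C}$, either $f(g(z))$ and $g(f(z))$ are both defined and equal, or neither is defined (both functions being undefined at $\infty$). Let $F(f)\subset\mathbb{C}$ be the Fatou set of $f$, that is, the set of points having a neighbourhood on which all iterates $f^n$, $n\in\mathbb{N}$, are defined and form a normal family with respect to the spherical metric. Let $U$ be a connected component of $F(f)$ on which some subsequence $(f^{n_k})_{k\ge 1}$ of $(f^n)_{n\ge 1}$ converges locally uniformly to a finite limit function $\varphi:U\to\mathbb{C}$. Then $g(U)\subset F(f)$. -/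

import Mathlib

open Filter Topology

/-- The Riemann sphere. -/
abbrev Sphere : Type := OnePoint ℂ

/-- The uniform structure of the Riemann sphere: the unique one that induces its (compact
Hausdorff) topology, that is, the one of the spherical or chordal metric. -/
noncomputable instance sphereUniformSpace : UniformSpace Sphere := uniformSpaceOfCompactR1

/-- `f : ℂ → Ĉ` is meromorphic in the plane: it is continuous as a map to the sphere and, near
every point, agrees off that point with a complex-valued meromorphic function. The value at a pole
is thus `∞`, and the constant `∞` is not meromorphic. -/
def IsMeromorphicFun (f : ℂ → Sphere) : Prop :=
  Continuous f ∧ ∃ F : ℂ → ℂ, Meromorphic F ∧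
    ∀ z, ∀ᶠ w in 𝓝[≠] z, f w = ((F w : ℂ) : Sphere)

/-- `f` as a self-map of the sphere, with the placeholder value `∞` at `∞`, where `f` is
undefined. Whether a composition is defined is always recorded separately. -/
def sphereExt (f : ℂ → Sphere) : Sphere → Sphere :=
  fun w => w.elim OnePoint.infty f

/-- `f` and `g` commute: at every `z`, either `f (g z)` and `g (f z)` are both defined (that is,
`g z` and `f z` are finite) and equal, or neither is defined. -/
def CommutingFun (f g : ℂ → Sphere) : Prop :=
  ∀ z : ℂ,
    (g z ≠ OnePoint.infty ∧ f z ≠ OnePoint.infty ∧ sphereExt f (g z) = sphereExt g (f z)) ∨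
    (g z = OnePoint.infty ∧ f z = OnePoint.infty)

/-- The `n`-th iterate of `f`, meaningful at the points where `IterDefined f n` holds. -/
def iter (f : ℂ → Sphere) (n : ℕ) (z : ℂ) : Sphere :=
  (sphereExt f)^[n] (z : Sphere)

/-- `fⁿ(z)` is defined: none of `z, f(z), …, fⁿ⁻¹(z)` is `∞`. -/
def IterDefined (f : ℂ → Sphere) (n : ℕ) (z : ℂ) : Prop :=
  ∀ m < n, iter f m z ≠ OnePoint.infty

/-- The family `(Fₙ)` is normal on `V`: every sequence of its members has a subsequence that
converges locally uniformly on `V` with respect to the spherical metric. -/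
def NormalFamilyOn (F : ℕ → ℂ → Sphere) (V : Set ℂ) : Prop :=
  ∀ s : ℕ → ℕ, ∃ φ : ℕ → ℕ, StrictMono φ ∧ ∃ h : ℂ → Sphere,
    TendstoLocallyUniformlyOn (fun k => F (s (φ k))) h atTop V

/-- The Fatou set `F(f) ⊆ ℂ`: the points with a neighbourhood on which all iterates of `f` are
defined and form a normal family. -/
def fatouSet (f : ℂ → Sphere) : Set ℂ :=
  {z | ∃ V : Set ℂ, IsOpen V ∧ z ∈ V ∧ (∀ w ∈ V, ∀ n, IterDefined f n w) ∧
    NormalFamilyOn (iter f) V}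

/-- `U` is a connected component of `F(f)`. -/
def IsFatouComponent (f : ℂ → Sphere) (U : Set ℂ) : Prop :=
  ∃ z ∈ fatouSet f, U = connectedComponentIn (fatouSet f) z

/-! Let `E` be the set of iterated preimages of `∞`. Commutation forces `f` and `g` to have the same
poles, so `g` maps the complement of `E` into itself and `fⁿ ∘ g = g ∘ fⁿ` there. Since `g` is open,
information on `U` gives information on a neighbourhood of each `w = g z₀`. If `E` has two points,
the iterates omit both near `w`, and Montel's theorem applies.

Otherwise `E` is empty or `{a}`, and `f` is a holomorphic self-map of `X = ℂ \ E`, with a pole at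
`a` in the second case. Suppose `w ∉ F(f)`.

If `φ z₀ ∈ X`, the iterates `f^{n_k}` send a neighbourhood of `w` close to `g (φ z₀) ∈ X`, hence
into a compact subset of `X`. This is impossible off the Fatou set
(`not_compactlyBoundedAt_of_notMem`): such boundedness spreads to all of `X` and yields a limit
function `H`. A constant `H` gives a compact neighbourhood mapped into itself by an iterate. A
nonconstant `H` makes the iterates of orders `n_{k+1} - n_k` accumulate at the identity, so `f` is
injective on `X`, hence affine or an involution, and every point of `X` is a Fatou point.

If `φ z₀ = a`, then `φ` is constant near `z₀` by Hurwitz, so `f^{n_k}` tends to `g a = ∞` at points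
near `w`. But periodic points accumulate at `w` (`exists_periodic_of_notMem`), and a periodic orbit
in `X` cannot tend to `∞`.

Montel's theorem comes from Bloch through Schottky. One omitted value may be a holomorphic function,
because the periodic points need the identity there. -/

open Metric Set

/-! ### Bloch's theorem -/

/-- If the derivative is at most twice as large on a disc as at its centre, then the image of the disc
contains a disc of comparable size. -/
theorem ball_subset_image_of_norm_deriv_le {f : ℂ → ℂ} {a : ℂ} {r : ℝ} (hr : 0 < r)
    (hf : DifferentiableOn ℂ f (ball a r)) (h0 : deriv f a ≠ 0)
    (hb : ∀ z ∈ ball a r, ‖deriv f z‖ ≤ 2 * ‖deriv f a‖) :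
    ball (f a) (r * ‖deriv f a‖ / 24) ⊆ f '' ball a r := by
  set M := ‖deriv f a‖ with hM
  have hM0 : 0 < M := norm_pos_iff.2 h0
  have hd : DifferentiableOn ℂ (deriv f) (ball a r) := hf.deriv isOpen_ball
  -- By the Schwarz lemma `f'` moves by at most `3M/r · r/6 = M/2` here. So on the circle of radius
  -- `r/6`, `‖f z - f a‖ ≥ Mr/6 - Mr/12`, and the quantitative open mapping theorem halves this to
  -- `rM/24`.
  have hsub : closedBall a (r / 6) ⊆ ball a r := closedBall_subset_ball (by linarith)
  have hmaps : MapsTo (deriv f) (ball a r) (closedBall (deriv f a) (3 * M)) := by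
    intro z hz
    rw [mem_closedBall, dist_eq_norm]
    have := norm_sub_le (deriv f z) (deriv f a)
    have := hb z hz
    linarith
  have hlip : ∀ z ∈ closedBall a (r / 6), ‖deriv f z - deriv f a‖ ≤ M / 2 := by
    intro z hz
    have h1 := Complex.dist_le_div_mul_dist_of_mapsTo_ball hd hmaps (hsub hz)
    rw [dist_eq_norm] at h1
    have h2 : dist z a ≤ r / 6 := hz
    calc _ ≤ 3 * M / r * dist z a := h1
      _ ≤ 3 * M / r * (r / 6) := by gcongr
      _ = M / 2 := by field_simp; norm_num
  have hmv : ∀ z ∈ closedBall a (r / 6),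
      ‖(f z - deriv f a * z) - (f a - deriv f a * a)‖ ≤ M / 2 * ‖z - a‖ := by
    intro z hz
    refine (convex_closedBall a (r / 6)).norm_image_sub_le_of_norm_hasDerivWithin_le
      (f := fun z => f z - deriv f a * z) (f' := fun z => deriv f z - deriv f a)
      (fun x hx => ?_) hlip (mem_closedBall_self (by linarith)) hz
    have h1 : HasDerivAt f (deriv f x) x :=
      (hf.differentiableAt (isOpen_ball.mem_nhds (hsub hx))).hasDerivAt
    have h2 := h1.fun_sub ((hasDerivAt_id x).const_mul (deriv f a))
    simpa using h2.hasDerivWithinAt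
  have hsph : ∀ z ∈ sphere a (r / 6), r * M / 12 ≤ ‖f z - f a‖ := by
    intro z hz
    have h1 := hmv z (sphere_subset_closedBall hz)
    have h2 : ‖z - a‖ = r / 6 := by simpa [dist_eq_norm] using hz
    have h3 : ‖deriv f a * (z - a)‖ = M * (r / 6) := by rw [norm_mul, h2]
    have h4 : deriv f a * (z - a)
        = (f z - f a) - ((f z - deriv f a * z) - (f a - deriv f a * a)) := by ring
    have h5 := norm_sub_le (f z - f a) ((f z - deriv f a * z) - (f a - deriv f a * a))
    rw [← h4, h3] at h5
    rw [h2] at h1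
    nlinarith
  have hdc : DiffContOnCl ℂ f (ball a (r / 6)) :=
    (hf.mono (closure_ball_subset_closedBall.trans hsub)).diffContOnCl
  have hne : ∃ᶠ z in 𝓝 a, f z ≠ f a := by
    have h1 : HasDerivAt f (deriv f a) a :=
      (hf.differentiableAt (isOpen_ball.mem_nhds (mem_ball_self hr))).hasDerivAt
    exact ((h1.eventually_ne h0 (c := f a)).frequently).filter_mono nhdsWithin_le_nhds
  have := hdc.ball_subset_image_closedBall (by linarith) hsph hne
  refine Subset.trans ?_ (this.trans (image_mono hsub))
  exact ball_subset_ball (by linarith)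

/-- **Bloch's theorem**: if the image of a disc contains no disc of radius `L`, then the derivative
at the centre is bounded. -/
theorem norm_deriv_mul_le_of_not_ball_subset_image {f : ℂ → ℂ} {c : ℂ} {R L : ℝ}
    (hf : DifferentiableOn ℂ f (ball c R)) (hL : 0 < L)
    (hno : ∀ w, ¬ ball w L ⊆ f '' ball c R) : ‖deriv f c‖ * R ≤ 48 * L := by
  by_cases hR : 0 < R
  swap
  · have := mul_nonneg (norm_nonneg (deriv f c)) (by linarith : 0 ≤ -R)
    linarith
  have key : ∀ ρ ∈ Ioo 0 R, ‖deriv f c‖ * ρ ≤ 48 * L := by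
    rintro ρ ⟨hρ, hρR⟩
    have hsub : closedBall c ρ ⊆ ball c R := closedBall_subset_ball hρR
    have hd : DifferentiableOn ℂ (deriv f) (ball c R) := hf.deriv isOpen_ball
    -- Landau's device: where this weight is maximal, the derivative at most doubles on the disc of
    -- radius half the distance to the boundary. That halving turns `24` into `48`.
    have hcont : ContinuousOn (fun z => ‖deriv f z‖ * (ρ - dist z c)) (closedBall c ρ) :=
      ((hd.continuousOn.mono hsub).norm).mul (by fun_prop)
    obtain ⟨z, hz, hmax⟩ := (isCompact_closedBall c ρ).exists_isMaxOn
      ⟨c, mem_closedBall_self hρ.le⟩ hcont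
    have h0 : ‖deriv f c‖ * ρ ≤ ‖deriv f z‖ * (ρ - dist z c) := by
      simpa using hmax (mem_closedBall_self hρ.le)
    by_contra! hcon
    have hpos : 0 < ‖deriv f z‖ * (ρ - dist z c) := by linarith
    have hz0 : 0 < ‖deriv f z‖ := by
      rcases (norm_nonneg (deriv f z)).eq_or_lt with h | h
      · rw [← h] at hpos; simp at hpos
      · exact h
    have ht : 0 < ρ - dist z c := pos_of_mul_pos_right hpos hz0.le
    set t := (ρ - dist z c) / 2 with ht_def
    have ht0 : 0 < t := by linarith
    have hball : ball z t ⊆ closedBall c ρ := by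
      intro x hx
      rw [mem_ball] at hx
      rw [mem_closedBall]
      have := dist_triangle x z c
      linarith
    have himg := ball_subset_image_of_norm_deriv_le ht0 (hf.mono (hball.trans hsub))
      (norm_pos_iff.1 hz0) (by
        intro x hx
        have h1 : ‖deriv f x‖ * (ρ - dist x c) ≤ ‖deriv f z‖ * (ρ - dist z c) := hmax (hball hx)
        have h2 : t ≤ ρ - dist x c := by
          rw [mem_ball] at hx
          have := dist_triangle x z c
          linarith
        have h3 : ‖deriv f x‖ * t ≤ 2 * ‖deriv f z‖ * t := by
          have := mul_le_mul_of_nonneg_left h2 (norm_nonneg (deriv f x))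
          nlinarith
        exact le_of_mul_le_mul_right h3 ht0)
    refine hno (f z) (Subset.trans (ball_subset_ball ?_)
      (himg.trans (image_mono (hball.trans hsub))))
    rw [ht_def]
    linarith
  have hcl : R ∈ closure (Ioo 0 R) := by
    rw [closure_Ioo hR.ne]; exact ⟨hR.le, le_rfl⟩
  have hclosed : IsClosed {ρ : ℝ | ‖deriv f c‖ * ρ ≤ 48 * L} :=
    isClosed_le (by fun_prop) (by fun_prop)
  exact (closure_minimal key hclosed) hcl

/-! ### Logarithms, arccosines and Schottky's theorem -/

/-- A zero-free holomorphic function on a disc has a holomorphic logarithm. -/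
theorem exists_log_on_ball {u : ℂ → ℂ} {c : ℂ} {R : ℝ} (hR : 0 < R)
    (hu : DifferentiableOn ℂ u (ball c R)) (h0 : ∀ z ∈ ball c R, u z ≠ 0) :
    ∃ v : ℂ → ℂ, DifferentiableOn ℂ v (ball c R) ∧ (∀ z ∈ ball c R, Complex.exp (v z) = u z) ∧
      v c = Complex.log (u c) := by
  have hq : DifferentiableOn ℂ (fun z => deriv u z / u z) (ball c R) :=
    (hu.deriv isOpen_ball).div hu h0
  obtain ⟨p, hp⟩ := hq.isExactOn_ball
  have hc : c ∈ ball c R := mem_ball_self hR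
  set v : ℂ → ℂ := fun z => p z - p c + Complex.log (u c) with hv
  have hv' : ∀ z ∈ ball c R, HasDerivAt v (deriv u z / u z) z := fun z hz =>
    ((hp z hz).sub_const _).add_const _
  have hvd : DifferentiableOn ℂ v (ball c R) := fun z hz =>
    (hv' z hz).differentiableAt.differentiableWithinAt
  have hconst : ∀ z ∈ ball c R, u z * Complex.exp (-v z) = u c * Complex.exp (-v c) := by
    intro z hz
    refine (convex_ball c R).is_const_of_fderivWithin_eq_zero (𝕜 := ℂ)
      (f := fun z => u z * Complex.exp (-v z)) ?_ ?_ hz hc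
    · exact hu.mul hvd.neg.cexp
    · intro x hx
      have h1 : HasDerivAt u (deriv u x) x :=
        (hu.differentiableAt (isOpen_ball.mem_nhds hx)).hasDerivAt
      have h2 := h1.mul ((hv' x hx).neg.cexp)
      have h3 : deriv u x * Complex.exp (-v x)
          + u x * (Complex.exp (-v x) * -(deriv u x / u x)) = 0 := by
        have := h0 x hx
        field_simp
        ring
      have h4 : HasDerivAt (fun z => u z * Complex.exp (-v z)) 0 x := by
        have h5 := h2
        simp only [Pi.neg_apply] at h5
        rw [h3] at h5
        exact h5
      rw [fderivWithin_of_isOpen isOpen_ball hx, h4.hasFDerivAt.fderiv]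
      ext; simp
  have hvc : v c = Complex.log (u c) := by simp [hv]
  refine ⟨v, hvd, fun z hz => ?_, hvc⟩
  have h1 := hconst z hz
  rw [hvc, Complex.exp_neg (Complex.log _), Complex.exp_log (h0 c hc),
    mul_inv_cancel₀ (h0 c hc), Complex.exp_neg] at h1
  exact (eq_of_mul_inv_eq_one h1).symm

/-- A holomorphic function on a disc omitting `1` and `-1` has a holomorphic `arccos`. -/
theorem exists_cos_pi_mul_eq_on_ball {f : ℂ → ℂ} {c : ℂ} {R : ℝ} (hR : 0 < R)
    (hf : DifferentiableOn ℂ f (ball c R)) (h1 : ∀ z ∈ ball c R, f z ≠ 1)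
    (h2 : ∀ z ∈ ball c R, f z ≠ -1) :
    ∃ F : ℂ → ℂ, DifferentiableOn ℂ F (ball c R) ∧
      (∀ z ∈ ball c R, Complex.cos (Real.pi * F z) = f z) ∧ ‖F c‖ ≤ 2 * ‖f c‖ + 1 := by
  have hc : c ∈ ball c R := mem_ball_self hR
  obtain ⟨v, hvd, hv, -⟩ := exists_log_on_ball hR (u := fun z => 1 - f z ^ 2)
    ((differentiableOn_const _).sub (hf.pow 2)) (by
      intro z hz h
      have : (1 - f z) * (1 + f z) = 0 := by linear_combination h
      rcases mul_eq_zero.1 this with h | h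
      · exact h1 z hz (by linear_combination -h)
      · exact h2 z hz (by linear_combination h))
  -- `h` is a square root of `1 - f²`, so `f + ih` has inverse `f - ih`, and its logarithm divided
  -- by `iπ` is the required `F`.
  set h : ℂ → ℂ := fun z => Complex.exp (v z / 2) with hh
  have hhd : DifferentiableOn ℂ h (ball c R) := (hvd.div_const 2).cexp
  have hsq : ∀ z ∈ ball c R, h z ^ 2 = 1 - f z ^ 2 := by
    intro z hz
    rw [← hv z hz, hh, ← Complex.exp_nat_mul]
    congr 1; push_cast; ring
  have hprod : ∀ z ∈ ball c R, (f z + Complex.I * h z) * (f z - Complex.I * h z) = 1 := by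
    intro z hz
    have := hsq z hz
    linear_combination this - h z ^ 2 * Complex.I_sq
  obtain ⟨w, hwd, hw, hwc⟩ := exists_log_on_ball hR (u := fun z => f z + Complex.I * h z)
    (hf.add (hhd.const_mul _)) (fun z hz => left_ne_zero_of_mul_eq_one (hprod z hz))
  have hpi : (Real.pi : ℂ) ≠ 0 := by exact_mod_cast Real.pi_ne_zero
  refine ⟨fun z => w z * (-Complex.I / Real.pi), hwd.mul_const _, fun z hz => ?_, ?_⟩
  · have e1 : (Real.pi : ℂ) * (w z * (-Complex.I / Real.pi)) = w z * -Complex.I := by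
      field_simp
    have e2 : w z * -Complex.I * Complex.I = w z := by
      linear_combination -(w z) * Complex.I_sq
    have e3 : -(w z * -Complex.I) * Complex.I = -w z := by
      linear_combination (w z) * Complex.I_sq
    rw [e1, Complex.cos, e2, e3, Complex.exp_neg, hw z hz,
      inv_eq_of_mul_eq_one_right (hprod z hz)]
    ring
  · have hnh : ‖h c‖ ≤ 1 + ‖f c‖ := by
      have h3 : ‖h c‖ ^ 2 ≤ 1 + ‖f c‖ ^ 2 := by
        rw [← norm_pow, hsq c hc]
        refine (norm_sub_le _ _).trans ?_
        simp
      have := norm_nonneg (f c)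
      nlinarith [norm_nonneg (h c)]
    have hp : ‖f c + Complex.I * h c‖ ≤ 2 * ‖f c‖ + 1 := by
      refine (norm_add_le _ _).trans ?_
      simp; linarith
    have hm : ‖f c - Complex.I * h c‖ ≤ 2 * ‖f c‖ + 1 := by
      refine (norm_sub_le _ _).trans ?_
      simp; linarith
    have hn1 : ‖f c + Complex.I * h c‖ * ‖f c - Complex.I * h c‖ = 1 := by
      rw [← norm_mul, hprod c hc, norm_one]
    have hn0 : 0 < ‖f c + Complex.I * h c‖ :=
      norm_pos_iff.2 (left_ne_zero_of_mul_eq_one (hprod c hc))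
    -- The lower bound for `log ‖f + ih‖` uses the norm of the inverse `f - ih`. The imaginary part
    -- is bounded because the logarithm is principal at `c`.
    have hre : |(w c).re| ≤ 2 * ‖f c‖ := by
      rw [hwc, Complex.log_re, abs_le]
      constructor
      · have := Real.one_sub_inv_le_log_of_pos hn0
        rw [inv_eq_of_mul_eq_one_right hn1] at this
        linarith
      · have := Real.log_le_sub_one_of_pos hn0
        linarith
    have him : |(w c).im| ≤ Real.pi := by
      rw [hwc, Complex.log_im]; exact Complex.abs_arg_le_pi _
    have hnw : ‖w c‖ ≤ 2 * ‖f c‖ + Real.pi := by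
      have := Complex.norm_le_abs_re_add_abs_im (w c)
      linarith
    have hpi3 := Real.pi_gt_three
    rw [norm_mul, norm_div, norm_neg, Complex.norm_I, Complex.norm_real,
      Real.norm_of_nonneg Real.pi_pos.le, mul_one_div, div_le_iff₀ Real.pi_pos]
    nlinarith [norm_nonneg (f c)]

/-- Over an interval of length `1/2` the function `cosh (π t)` grows by at least `1`, so it passes
through an integer. This makes the set where `cos (π z)` is an integer meet every unit disc. -/
theorem exists_cosh_pi_mul_eq_nat {y : ℝ} (hy : 0 ≤ y) :
    ∃ t ∈ Icc y (y + 1 / 2), ∃ n : ℕ, Real.cosh (Real.pi * t) = n := by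
  have hpi := Real.pi_gt_three
  have h1 : 2 ≤ Real.cosh (Real.pi * (1 / 2)) := by
    have h2 : Real.cosh (3 / 2) ≤ Real.cosh (Real.pi * (1 / 2)) := by
      rw [Real.cosh_le_cosh, abs_of_nonneg (by norm_num), abs_of_nonneg (by linarith)]
      linarith
    have h3 : 2 ≤ Real.cosh (3 / 2) := by
      rw [Real.cosh_eq]
      have h4 := Real.quadratic_le_exp_of_nonneg (x := 3 / 2) (by norm_num)
      have h5 := Real.exp_pos (-(3 / 2) : ℝ)
      have h6 : (4 : ℝ) ≤ Real.exp (3 / 2) := by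
        have : Real.exp (3 / 2) = Real.exp (3 / 4) ^ 2 := by
          rw [← Real.exp_nat_mul]; norm_num
        have h7 := Real.quadratic_le_exp_of_nonneg (x := 3 / 4) (by norm_num)
        rw [this]; nlinarith
      linarith
    linarith
  have h2 : Real.cosh (Real.pi * y) + 1 ≤ Real.cosh (Real.pi * (y + 1 / 2)) := by
    rw [mul_add, Real.cosh_add]
    have h3 : 0 ≤ Real.sinh (Real.pi * y) := Real.sinh_nonneg_iff.2 (by positivity)
    have h4 : 0 ≤ Real.sinh (Real.pi * (1 / 2)) := Real.sinh_nonneg_iff.2 (by positivity)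
    have h5 := Real.one_le_cosh (Real.pi * y)
    nlinarith [mul_nonneg h3 h4]
  have hcont : ContinuousOn (fun t => Real.cosh (Real.pi * t)) (Icc y (y + 1 / 2)) :=
    (Real.continuous_cosh.comp (by fun_prop)).continuousOn
  have hmem : (⌈Real.cosh (Real.pi * y)⌉₊ : ℝ) ∈
      Icc (Real.cosh (Real.pi * y)) (Real.cosh (Real.pi * (y + 1 / 2))) :=
    ⟨Nat.le_ceil _, (Nat.ceil_lt_add_one (Real.cosh_pos _).le).le.trans h2⟩
  obtain ⟨t, ht, htn⟩ := intermediate_value_Icc (by linarith) hcont hmem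
  exact ⟨t, ht, _, htn⟩

theorem cos_add_int_mul_pi_eq (x : ℂ) (n : ℤ) :
    Complex.cos (x + n * Real.pi) = Int.negOnePow n * Complex.cos x := by
  have h1 : Complex.cos (n * Real.pi) = (-1) ^ n := by
    have := congrArg (fun t : ℝ => (t : ℂ)) (Real.cos_int_mul_pi n)
    push_cast at this
    exact this
  have h2 : Complex.sin (n * Real.pi) = 0 := Complex.sin_int_mul_pi n
  rw [Complex.cos_add, h1, h2, Int.cast_negOnePow]
  ring

/-- Every disc of radius `1` contains a point at which `cos (π z)` is an integer. -/
theorem exists_mem_ball_cos_pi_mul_eq_int (w : ℂ) :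
    ∃ p ∈ ball w 1, ∃ n : ℤ, Complex.cos (Real.pi * p) = n := by
  obtain ⟨t, ht, n, hn⟩ : ∃ t : ℝ, |t - w.im| ≤ 1 / 2 ∧ ∃ n : ℕ, Real.cosh (Real.pi * t) = n := by
    rcases le_total 0 w.im with h | h
    · obtain ⟨t, ht, n, hn⟩ := exists_cosh_pi_mul_eq_nat h
      exact ⟨t, by rw [abs_le]; constructor <;> linarith [ht.1, ht.2], n, hn⟩
    · obtain ⟨t, ht, n, hn⟩ := exists_cosh_pi_mul_eq_nat (neg_nonneg.2 h)
      exact ⟨-t, by rw [abs_le]; constructor <;> linarith [ht.1, ht.2], n, by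
        rw [mul_neg, Real.cosh_neg, hn]⟩
  set m := round w.re with hm
  have hmr : |(m : ℝ) - w.re| ≤ 1 / 2 := by
    rw [abs_sub_comm]; exact abs_sub_round w.re
  refine ⟨m + t * Complex.I, ?_, Int.negOnePow m * n, ?_⟩
  · rw [mem_ball, dist_eq_norm, ← sq_lt_one_iff₀ (norm_nonneg _), Complex.sq_norm,
      Complex.normSq_apply]
    have e1 : ((m : ℂ) + t * Complex.I - w).re = m - w.re := by simp
    have e2 : ((m : ℂ) + t * Complex.I - w).im = t - w.im := by simp
    rw [e1, e2]
    have h1 := sq_le_sq' (by linarith [(abs_le.1 hmr).1]) (abs_le.1 hmr).2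
    have h2 := sq_le_sq' (by linarith [(abs_le.1 ht).1]) (abs_le.1 ht).2
    nlinarith
  · have e : (Real.pi : ℂ) * (m + t * Complex.I)
        = ((Real.pi * t : ℝ) : ℂ) * Complex.I + m * Real.pi := by push_cast; ring
    rw [e, cos_add_int_mul_pi_eq, Complex.cos_mul_I, ← Complex.ofReal_cosh, hn]
    push_cast
    rfl

theorem norm_cos_le_exp_norm (z : ℂ) : ‖Complex.cos z‖ ≤ Real.exp ‖z‖ := by
  rw [Complex.cos, norm_div]
  have h1 := norm_add_le (Complex.exp (z * Complex.I)) (Complex.exp (-z * Complex.I))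
  have h2 := Complex.norm_exp_le_exp_norm (z * Complex.I)
  have h3 := Complex.norm_exp_le_exp_norm (-z * Complex.I)
  simp only [norm_mul, norm_neg, Complex.norm_I, mul_one] at h2 h3
  have h4 : ‖(2 : ℂ)‖ = 2 := by simp
  rw [h4]; linarith

/-- **Schottky's theorem**. -/
theorem exists_bound_of_omits_zero_one (A : ℝ) : ∃ C : ℝ, ∀ (f : ℂ → ℂ) (c : ℂ) (R : ℝ), 0 < R →
    DifferentiableOn ℂ f (ball c R) → (∀ z ∈ ball c R, f z ≠ 0) → (∀ z ∈ ball c R, f z ≠ 1) →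
    ‖f c‖ ≤ A → ∀ z ∈ ball c (R / 2), ‖f z‖ ≤ C := by
  -- Bounds at the centre: `2A + 1` for `2f - 1`, then `x ↦ 2x + 1` for each of the two arccosines.
  -- `G` varies by at most `48`, and each cosine going back costs an exponential.
  refine ⟨(1 + Real.exp (Real.pi * Real.exp (Real.pi * (48 + (2 * (2 * (2 * A + 1) + 1) + 1))))) / 2,
    fun f c R hR hf h0 h1 hA z hz => ?_⟩
  have hc : c ∈ ball c R := mem_ball_self hR
  obtain ⟨F, hFd, hF, hFc⟩ := exists_cos_pi_mul_eq_on_ball hR (f := fun z => 2 * f z - 1)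
    ((hf.const_mul 2).sub_const 1) (fun z hz h => h1 z hz (by linear_combination h / 2))
    (fun z hz h => h0 z hz (by linear_combination h / 2))
  have hFint : ∀ z ∈ ball c R, ∀ n : ℤ, F z ≠ n := by
    intro z hz n hn
    have h3 := hF z hz
    have h4 : Complex.cos (Real.pi * n) = Int.negOnePow n := by
      have := cos_add_int_mul_pi_eq 0 n
      rw [zero_add, Complex.cos_zero, mul_one] at this
      rw [mul_comm, this]
    rw [hn, h4] at h3
    rcases Int.even_or_odd n with he | ho
    · rw [Int.negOnePow_even n he] at h3
      simp at h3
      exact h1 z hz (by linear_combination -h3 / 2)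
    · rw [Int.negOnePow_odd n ho] at h3
      simp at h3
      exact h0 z hz (by linear_combination -h3 / 2)
  obtain ⟨G, hGd, hG, hGc⟩ := exists_cos_pi_mul_eq_on_ball hR hFd
    (fun z hz => by simpa using hFint z hz 1) (fun z hz => by simpa using hFint z hz (-1))
  -- `F` omits all integers, so `G` omits every point where `cos (π z)` is an integer; Bloch on
  -- discs of radius `R/2` then bounds `G'` by `96/R`.
  have hno : ∀ w, ¬ ball w 1 ⊆ G '' ball c R := by
    intro w hw
    obtain ⟨p, hp, n, hn⟩ := exists_mem_ball_cos_pi_mul_eq_int w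
    obtain ⟨x, hx, rfl⟩ := hw hp
    exact hFint x hx n ((hG x hx).symm.trans hn)
  have hGder : ∀ x ∈ ball c (R / 2), ‖deriv G x‖ ≤ 96 / R := by
    intro x hx
    have hsub : ball x (R / 2) ⊆ ball c R := by
      refine ball_subset_ball' ?_
      rw [mem_ball] at hx; linarith
    have := norm_deriv_mul_le_of_not_ball_subset_image (hGd.mono hsub) one_pos
      (fun w hw => hno w (hw.trans (image_mono hsub)))
    rw [le_div_iff₀ hR]; linarith
  have hsub2 : ball c (R / 2) ⊆ ball c R := ball_subset_ball (by linarith)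
  have hGz : ‖G z - G c‖ ≤ 48 := by
    have h3 := (convex_ball c (R / 2)).norm_image_sub_le_of_norm_deriv_le (𝕜 := ℂ) (f := G)
      (fun x hx => hGd.differentiableAt (isOpen_ball.mem_nhds (hsub2 hx))) hGder
      (mem_ball_self (by linarith)) hz
    rw [mem_ball, dist_eq_norm] at hz
    refine h3.trans ?_
    calc 96 / R * ‖z - c‖ ≤ 96 / R * (R / 2) := by gcongr
      _ = 48 := by field_simp; norm_num
  have hF1c : ‖2 * f c - 1‖ ≤ 2 * A + 1 := by
    refine (norm_sub_le _ _).trans ?_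
    simp; linarith
  have hGn : ‖G z‖ ≤ 48 + (2 * (2 * (2 * A + 1) + 1) + 1) := by
    have := norm_le_insert' (G z) (G c)
    linarith
  have hpi := Real.pi_pos
  have hFn : ‖F z‖ ≤ Real.exp (Real.pi * (48 + (2 * (2 * (2 * A + 1) + 1) + 1))) := by
    rw [← hG z (hsub2 hz)]
    refine (norm_cos_le_exp_norm _).trans ?_
    rw [norm_mul, Complex.norm_real, Real.norm_of_nonneg hpi.le]
    gcongr
  have hfn : ‖2 * f z - 1‖ ≤
      Real.exp (Real.pi * Real.exp (Real.pi * (48 + (2 * (2 * (2 * A + 1) + 1) + 1)))) := by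
    rw [← hF z (hsub2 hz)]
    refine (norm_cos_le_exp_norm _).trans ?_
    rw [norm_mul, Complex.norm_real, Real.norm_of_nonneg hpi.le]
    gcongr
  have e : f z = ((2 * f z - 1) + 1) / 2 := by ring
  rw [e, norm_div]
  have h5 := norm_add_le (2 * f z - 1) 1
  have h4 : ‖(2 : ℂ)‖ = 2 := by simp
  rw [norm_one] at h5
  rw [h4]; linarith

/-! ### Locally bounded families and Hurwitz's theorem -/

/-- **Montel's theorem** for locally bounded sequences of holomorphic functions. -/
theorem exists_subseq_tendstoLocallyUniformlyOn {X : Set ℂ} (hX : IsOpen X) {u : ℕ → ℂ → ℂ}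
    (hu : ∀ k, DifferentiableOn ℂ (u k) X)
    (hb : ∀ p ∈ X, ∃ N ∈ 𝓝 p, ∃ M : ℝ, ∀ᶠ k in atTop, ∀ x ∈ N, ‖u k x‖ ≤ M) :
    ∃ φ : ℕ → ℕ, StrictMono φ ∧ ∃ h : ℂ → ℂ,
      TendstoLocallyUniformlyOn (fun k => u (φ k)) h atTop X := by
  classical
  have hb' : ∀ p ∈ X, ∃ r > 0, ball p r ⊆ X ∧ ∃ M : ℝ, ∀ k, ∀ x ∈ ball p r, ‖u k x‖ ≤ M := by
    intro p hp
    obtain ⟨N, hN, M, hM⟩ := hb p hp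
    obtain ⟨k₀, hk₀⟩ := eventually_atTop.1 hM
    have h1 : ∀ᶠ x in 𝓝 p, ∀ k ∈ Finset.range k₀, ‖u k x‖ ≤ ‖u k p‖ + 1 := by
      rw [eventually_all_finset]
      intro k _
      have hc : ContinuousAt (fun x => ‖u k x‖) p :=
        (((hu k).continuousOn).continuousAt (hX.mem_nhds hp)).norm
      filter_upwards [hc.eventually_lt (continuousAt_const (y := ‖u k p‖ + 1)) (by simp)] with x hx
      exact hx.le
    obtain ⟨r, hr, hball⟩ := Metric.mem_nhds_iff.1 (inter_mem (inter_mem hN (hX.mem_nhds hp)) h1)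
    refine ⟨r, hr, fun x hx => (hball hx).1.2,
      max M (∑ k ∈ Finset.range k₀, (‖u k p‖ + 1)), fun k x hx => ?_⟩
    rcases lt_or_ge k k₀ with hk | hk
    · refine le_max_of_le_right (((hball hx).2 k (Finset.mem_range.2 hk)).trans ?_)
      exact Finset.single_le_sum (f := fun k => ‖u k p‖ + 1) (fun i _ => by positivity)
        (Finset.mem_range.2 hk)
    · exact le_max_of_le_left (hk₀ k hk x (hball hx).1.1)
  have : LocallyCompactSpace X := hX.locallyCompactSpace
  let v : ℕ → C(X, ℂ) := fun k =>
    ⟨fun x => u k x, continuousOn_iff_continuous_domRestrict.1 (hu k).continuousOn⟩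
  have hequi : Equicontinuous (fun k => (v k : X → ℂ)) := by
    rintro ⟨p, hp⟩
    obtain ⟨r, hr, hsub, M, hM⟩ := hb' p hp
    -- The Schwarz lemma turns the local bound `M` into a Lipschitz bound independent of `k`;
    -- Arzelà–Ascoli then applies.
    refine Metric.equicontinuousAt_of_continuity_modulus (fun x : X => 2 * M / r * dist (x : ℂ) p) ?_ _ ?_
    · have : Continuous fun x : X => 2 * M / r * dist (x : ℂ) p := by fun_prop
      simpa using this.tendsto ⟨p, hp⟩
    · have : ∀ᶠ x : X in 𝓝 ⟨p, hp⟩, (x : ℂ) ∈ ball p r :=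
        continuous_subtype_val.continuousAt.eventually (ball_mem_nhds p hr)
      filter_upwards [this] with x hx k
      rw [dist_comm]
      refine Complex.dist_le_div_mul_dist_of_mapsTo_ball ((hu k).mono hsub) (fun y hy => ?_) hx
      rw [mem_closedBall, dist_eq_norm]
      have h1 := hM k y hy
      have h2 := hM k p (mem_ball_self hr)
      have h3 := norm_sub_le (u k y) (u k p)
      linarith
  have hcomp : IsCompact (closure (range v)) := by
    refine ArzelaAscoli.isCompact_closure_of_isClosedEmbedding (𝔖 := {K : Set X | IsCompact K})
      (F := fun w : C(X, ℂ) => (w : X → ℂ)) (fun K hK => hK) ?_ ?_ ?_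
    · have : T2Space (UniformOnFun X ℂ {K : Set X | IsCompact K}) :=
        UniformOnFun.t2Space_of_covering (eq_univ_of_forall fun x =>
          mem_sUnion_of_mem (mem_singleton x) isCompact_singleton)
      exact ContinuousMap.isUniformEmbedding_toUniformOnFunIsCompact.isClosedEmbedding
    · intro K _
      have h1 : Equicontinuous ((fun w : C(X, ℂ) => (w : X → ℂ)) ∘ ((↑) : range v → C(X, ℂ))) := by
        intro p U hU
        filter_upwards [hequi p U hU] with x hx
        rintro ⟨_, k, rfl⟩
        exact hx k
      exact h1.equicontinuousOn K
    · rintro K _ ⟨p, hp⟩ _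
      obtain ⟨r, hr, hsub, M, hM⟩ := hb' p hp
      refine ⟨closedBall 0 M, isCompact_closedBall _ _, ?_⟩
      rintro _ ⟨k, rfl⟩
      rw [mem_closedBall_zero_iff]
      exact hM k p (mem_ball_self hr)
  obtain ⟨h, -, φ, hφ, hlim⟩ := hcomp.tendsto_subseq (fun k => subset_closure (mem_range_self k))
  refine ⟨φ, hφ, fun z => if hz : z ∈ X then h ⟨z, hz⟩ else 0, ?_⟩
  rw [tendstoLocallyUniformlyOn_iff_tendstoLocallyUniformly_comp_coe]
  rw [ContinuousMap.tendsto_iff_tendstoLocallyUniformly] at hlim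
  have heq : (fun z => if hz : z ∈ X then h ⟨z, hz⟩ else 0) ∘ ((↑) : X → ℂ) = h := by
    funext z
    simp
  rw [heq]
  exact hlim

/-- **Hurwitz's theorem**: near a point where the limit is not constant, the images of the
approximants contain a fixed disc. -/
theorem exists_ball_subset_image_of_tendstoLocallyUniformlyOn {X : Set ℂ} (hX : IsOpen X)
    {u : ℕ → ℂ → ℂ} {h : ℂ → ℂ} (hu : ∀ k, DifferentiableOn ℂ (u k) X)
    (hlim : TendstoLocallyUniformlyOn u h atTop X) {z : ℂ} (hz : z ∈ X)
    (hne : ¬ ∀ᶠ x in 𝓝 z, h x = h z) {s : Set ℂ} (hs : s ∈ 𝓝 z) :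
    ∃ ε > 0, ∀ᶠ k in atTop, ball (h z) ε ⊆ u k '' s := by
  have hd : DifferentiableOn ℂ h X := hlim.differentiableOn (.of_forall hu) hX
  have han : AnalyticAt ℂ h z := hd.analyticAt (hX.mem_nhds hz)
  have hiso : ∀ᶠ x in 𝓝[≠] z, h x ≠ h z :=
    (han.eventually_eq_or_eventually_ne analyticAt_const).resolve_left hne
  rw [eventually_nhdsWithin_iff] at hiso
  obtain ⟨R, hR, hball⟩ := Metric.mem_nhds_iff.1 (inter_mem (inter_mem hs (hX.mem_nhds hz)) hiso)
  have hcl : closedBall z (R / 2) ⊆ ball z R := closedBall_subset_ball (by linarith)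
  have hBX : ball z R ⊆ X := fun x hx => (hball hx).1.2
  obtain ⟨ε, hε, hmin⟩ : ∃ ε > 0, ∀ x ∈ sphere z (R / 2), ε ≤ ‖h x - h z‖ := by
    obtain ⟨y, hy, hymin⟩ := (isCompact_sphere z (R / 2)).exists_isMinOn
      (NormedSpace.sphere_nonempty.2 (by linarith)) (f := fun x => ‖h x - h z‖)
      (((hd.continuousOn.mono (sphere_subset_closedBall.trans (hcl.trans hBX))).sub
        continuousOn_const).norm)
    refine ⟨_, norm_pos_iff.2 (sub_ne_zero.2 ?_), fun x hx => hymin hx⟩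
    exact (hball (hcl (sphere_subset_closedBall hy))).2
      (ne_of_mem_sphere hy (by linarith))
  -- With error below `ε/8`, `u k` keeps distance `ε/2` from `u k z` on the circle. Its image
  -- contains a disc of radius `ε/4` about `u k z`, hence one of radius `ε/8` about `h z`.
  refine ⟨ε / 8, by linarith, ?_⟩
  have hunif := ((tendstoLocallyUniformlyOn_iff_forall_isCompact hX).1 hlim) _
    (hcl.trans hBX) (isCompact_closedBall z (R / 2))
  filter_upwards [Metric.tendstoUniformlyOn_iff.1 hunif (ε / 8) (by linarith)] with k hk
  have hkz := hk z (mem_closedBall_self (by linarith))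
  rw [dist_eq_norm] at hkz
  have hsph : ∀ x ∈ sphere z (R / 2), ε / 2 ≤ ‖u k x - u k z‖ := by
    intro x hx
    have h1 := hk x (sphere_subset_closedBall hx)
    rw [dist_eq_norm] at h1
    have h2 := hmin x hx
    have h3 : h x - h z = (h x - u k x) + (u k x - u k z) - (h z - u k z) := by ring
    have h4 := norm_sub_le ((h x - u k x) + (u k x - u k z)) (h z - u k z)
    have h5 := norm_add_le (h x - u k x) (u k x - u k z)
    rw [← h3] at h4
    linarith
  have hfreq : ∃ᶠ x in 𝓝 z, u k x ≠ u k z := by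
    intro hcon
    simp only [ne_eq, not_not] at hcon
    have h1 : AnalyticOnNhd ℂ (u k) (ball z R) := ((hu k).mono hBX).analyticOnNhd isOpen_ball
    have h2 : EqOn (u k) (fun _ => u k z) (ball z R) :=
      h1.eqOn_of_preconnected_of_eventuallyEq analyticOnNhd_const
        (convex_ball z R).isPreconnected (mem_ball_self hR) hcon
    obtain ⟨y, hy⟩ := NormedSpace.sphere_nonempty (x := z) (r := R / 2) |>.2 (by linarith)
    have h3 := hsph y hy
    rw [h2 (hcl (sphere_subset_closedBall hy))] at h3
    simp at h3
    linarith
  have hdc : DiffContOnCl ℂ (u k) (ball z (R / 2)) :=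
    ((hu k).mono (closure_ball_subset_closedBall.trans (hcl.trans hBX))).diffContOnCl
  have himg := hdc.ball_subset_image_closedBall (by linarith) hsph hfreq
  refine Subset.trans (ball_subset_ball' ?_) (himg.trans (image_mono fun x hx => (hball (hcl hx)).1.1))
  rw [dist_eq_norm]; linarith

/-! ### Entire functions that must be affine -/

/-- An entire function of at most linear growth is affine. -/
theorem exists_eq_add_mul_of_linear_growth {v : ℂ → ℂ} (hv : Differentiable ℂ v) {c : ℂ} {C : ℝ}
    (hb : ∀ z, 1 ≤ ‖z - c‖ → ‖v z‖ ≤ C * ‖z - c‖) : ∃ k : ℂ, ∀ z, v z = v c + k * (z - c) := by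
  have hC : 0 ≤ C := by
    have := hb (c + 1) (by simp)
    simp at this
    exact (norm_nonneg _).trans this
  have hder : ∀ x, ‖deriv v x‖ ≤ 2 * C := by
    intro x
    -- A circle of this radius about `x` stays at distance at least `1` from `c`, so the growth
    -- bound is available for Cauchy's estimate; Liouville then applies to `v'`.
    have hr : 0 < ‖x - c‖ + 1 := by positivity
    have h1 := Complex.norm_deriv_le_of_forall_mem_sphere_norm_le (c := x) (f := v)
      (C := C * (2 * (‖x - c‖ + 1))) hr hv.diffContOnCl (by
        intro z hz
        rw [mem_sphere, dist_eq_norm] at hz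
        have h2 : ‖z - c‖ ≤ ‖z - x‖ + ‖x - c‖ := norm_sub_le_norm_sub_add_norm_sub z x c
        have h3 : ‖z - x‖ ≤ ‖z - c‖ + ‖x - c‖ := by
          have := norm_sub_le (z - c) (x - c)
          rwa [sub_sub_sub_cancel_right] at this
        refine (hb z (by linarith)).trans (mul_le_mul_of_nonneg_left (by linarith) hC))
    refine h1.trans (le_of_eq ?_)
    field_simp
  have hdd : Differentiable ℂ (deriv v) := fun x =>
    ((hv.differentiableOn (s := univ)).deriv isOpen_univ).differentiableAt univ_mem
  have hconst : ∀ x, deriv v x = deriv v c := fun x =>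
    hdd.apply_eq_apply_of_bounded (isBounded_iff_forall_norm_le.2
      ⟨2 * C, by rintro _ ⟨x, rfl⟩; exact hder x⟩) x c
  refine ⟨deriv v c, fun z => ?_⟩
  have h1 : ∀ x, HasDerivAt (fun z => v z - deriv v c * z) 0 x := by
    intro x
    have h2 := (hv x).hasDerivAt.fun_sub ((hasDerivAt_id x).const_mul (deriv v c))
    rw [hconst x] at h2
    simpa using h2
  have h3 := is_const_of_deriv_eq_zero (fun x => (h1 x).differentiableAt) (fun x => (h1 x).deriv) z c
  linear_combination h3

/-- Injective entire functions are affine. -/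
theorem exists_eq_mul_add_of_injective {f : ℂ → ℂ} (hf : Differentiable ℂ f)
    (hinj : Function.Injective f) : ∃ α β : ℂ, ∀ z, f z = α * z + β := by
  obtain ⟨c, hc⟩ : ∃ c, deriv f c ≠ 0 := by
    by_contra! h
    exact zero_ne_one (hinj (is_const_of_deriv_eq_zero hf h 0 1))
  -- The difference quotient at `c` is entire and zero-free. Injectivity and openness keep `f` away
  -- from `f c` off the unit disc, so its reciprocal grows at most linearly. It is then affine
  -- without zeros, hence constant.
  have hds : Differentiable ℂ (dslope f c) := fun x =>
    ((Complex.differentiableOn_dslope (univ_mem : univ ∈ 𝓝 c)).2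
      hf.differentiableOn).differentiableAt univ_mem
  have hne : ∀ z, dslope f c z ≠ 0 := by
    intro z
    rcases eq_or_ne z c with rfl | h
    · rwa [dslope_same]
    · rw [dslope_of_ne f h, slope_def_field]
      exact div_ne_zero (sub_ne_zero.2 (hinj.ne h)) (sub_ne_zero.2 h)
  have hopen : f '' ball c 1 ∈ 𝓝 (f c) := by
    have h1 : HasStrictDerivAt f (deriv f c) c :=
      (hf.analyticAt c).hasStrictDerivAt
    rw [← h1.map_nhds_eq hc]
    exact image_mem_map (ball_mem_nhds c one_pos)
  obtain ⟨ε, hε, hball⟩ := Metric.mem_nhds_iff.1 hopen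
  have hfar : ∀ z, 1 ≤ ‖z - c‖ → ε ≤ ‖f z - f c‖ := by
    intro z hz
    by_contra! hcon
    obtain ⟨x, hx, hxz⟩ := hball (show f z ∈ ball (f c) ε by rwa [mem_ball, dist_eq_norm])
    rw [hinj hxz, mem_ball, dist_eq_norm] at hx
    linarith
  obtain ⟨k, hk⟩ := exists_eq_add_mul_of_linear_growth (v := fun z => (dslope f c z)⁻¹)
    (hds.inv hne) (c := c) (C := 1 / ε) (by
      intro z hz
      have hzc : z ≠ c := by rintro rfl; simp at hz; linarith
      rw [dslope_of_ne f hzc, slope_def_field, inv_div, norm_div, one_div_mul_eq_div]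
      have := hfar z hz
      gcongr)
  have hk0 : k = 0 := by
    by_contra hk0
    have h1 := hk (c - (dslope f c c)⁻¹ / k)
    refine inv_ne_zero (hne (c - (dslope f c c)⁻¹ / k)) (h1.trans ?_)
    field_simp
    ring
  refine ⟨deriv f c, f c - deriv f c * c, fun z => ?_⟩
  have h1 := hk z
  rw [hk0, zero_mul, add_zero, inv_inj, dslope_same] at h1
  have h2 := sub_smul_dslope f c z
  rw [h1, smul_eq_mul] at h2
  linear_combination -h2

/-! ### Continuous convergence and the sphere -/

/-- The joint limit allows evaluation at moving points, and passes through continuous maps without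
any uniform continuity. -/
theorem TendstoLocallyUniformlyOn.tendsto_prod_nhds {β : Type*} [UniformSpace β] {F : ℕ → ℂ → β}
    {h : ℂ → β} {V : Set ℂ} (hlim : TendstoLocallyUniformlyOn F h atTop V) (hV : IsOpen V)
    (hc : ContinuousOn h V) {x : ℂ} (hx : x ∈ V) :
    Tendsto (fun p : ℕ × ℂ => F p.1 p.2) (atTop ×ˢ 𝓝 x) (𝓝 (h x)) := by
  have h1 := tendstoLocallyUniformlyOn_iff_forall_tendsto.1 hlim x hx
  rw [hV.nhdsWithin_eq hx] at h1
  have h2 : Tendsto (fun p : ℕ × ℂ => h p.2) (atTop ×ˢ 𝓝 x) (𝓝 (h x)) :=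
    (hc.continuousAt (hV.mem_nhds hx)).tendsto.comp tendsto_snd
  exact Uniform.tendsto_nhds_right.2 ((Uniform.tendsto_nhds_right.1 h2).uniformity_trans h1)

/-- Continuous convergence implies locally uniform convergence. -/
theorem tendstoLocallyUniformlyOn_of_tendsto_prod_nhds {β : Type*} [UniformSpace β]
    {F : ℕ → ℂ → β} {h : ℂ → β} {V : Set ℂ} (hV : IsOpen V) (hc : ContinuousOn h V)
    (H : ∀ x ∈ V, Tendsto (fun p : ℕ × ℂ => F p.1 p.2) (atTop ×ˢ 𝓝 x) (𝓝 (h x))) :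
    TendstoLocallyUniformlyOn F h atTop V := by
  rw [tendstoLocallyUniformlyOn_iff_forall_tendsto]
  intro x hx
  rw [hV.nhdsWithin_eq hx]
  have h2 : Tendsto (fun p : ℕ × ℂ => h p.2) (atTop ×ˢ 𝓝 x) (𝓝 (h x)) :=
    (hc.continuousAt (hV.mem_nhds hx)).tendsto.comp tendsto_snd
  exact (h2.prodMk_nhds (H x hx)).mono_right (nhds_le_uniformity (h x))

/-- Locally uniform convergence to a continuous limit is preserved by continuous maps. -/
theorem TendstoLocallyUniformlyOn.continuous_comp {β γ : Type*} [UniformSpace β] [UniformSpace γ]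
    {F : ℕ → ℂ → β} {h : ℂ → β} {V : Set ℂ} {J : β → γ} (hJ : Continuous J)
    (hlim : TendstoLocallyUniformlyOn F h atTop V) (hV : IsOpen V) (hc : ContinuousOn h V) :
    TendstoLocallyUniformlyOn (fun k z => J (F k z)) (fun z => J (h z)) atTop V :=
  tendstoLocallyUniformlyOn_of_tendsto_prod_nhds hV (hJ.comp_continuousOn hc) fun _ hx =>
    (hJ.tendsto _).comp (hlim.tendsto_prod_nhds hV hc hx)

/-- The finite part of a point of the sphere, with placeholder `0` at `∞`. -/
noncomputable def finitePart (w : Sphere) : ℂ := w.elim 0 id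

@[simp] theorem finitePart_coe (z : ℂ) : finitePart (z : Sphere) = z := rfl

theorem coe_finitePart {w : Sphere} (hw : w ≠ OnePoint.infty) : (finitePart w : Sphere) = w := by
  obtain ⟨z, rfl⟩ := OnePoint.ne_infty_iff_exists.1 hw
  rfl

theorem continuousAt_finitePart {w : Sphere} (hw : w ≠ OnePoint.infty) :
    ContinuousAt finitePart w := by
  obtain ⟨z, rfl⟩ := OnePoint.ne_infty_iff_exists.1 hw
  rw [OnePoint.continuousAt_coe]
  exact continuousAt_id

@[simp] theorem sphereExt_coe (f : ℂ → Sphere) (z : ℂ) : sphereExt f (z : Sphere) = f z := rfl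

@[simp] theorem iter_zero_eq (f : ℂ → Sphere) (z : ℂ) : iter f 0 z = z := rfl

theorem iter_succ_eq (f : ℂ → Sphere) (n : ℕ) (z : ℂ) :
    iter f (n + 1) z = sphereExt f (iter f n z) := by
  rw [iter, Function.iterate_succ_apply']; rfl

/-- The map `v ↦ a + β / v` as a continuous map into the sphere. -/
theorem continuous_add_div_sphere (a : ℂ) {β : ℂ} (hβ : β ≠ 0) :
    Continuous fun v : ℂ => if v = 0 then OnePoint.infty else ((a + β / v : ℂ) : Sphere) := by
  rw [continuous_iff_continuousAt]
  intro v
  rcases eq_or_ne v 0 with rfl | hv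
  · rw [continuousAt_iff_punctured_nhds]
    simp only [if_true]
    have h1 : Tendsto (fun v : ℂ => a + β / v) (𝓝[≠] 0) (Bornology.cobounded ℂ) := by
      rw [← tendsto_norm_atTop_iff_cobounded]
      have h2 : Tendsto (fun v : ℂ => ‖β‖ * ‖v⁻¹‖ - ‖a‖) (𝓝[≠] 0) atTop :=
        tendsto_atTop_add_const_right _ _ (Tendsto.const_mul_atTop (norm_pos_iff.2 hβ)
          (tendsto_norm_cobounded_atTop.comp tendsto_inv₀_nhdsNE_zero))
      refine tendsto_atTop_mono (fun v => ?_) h2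
      have h3 := norm_sub_le (a + β / v) a
      rw [add_sub_cancel_left, div_eq_mul_inv, norm_mul] at h3
      rw [div_eq_mul_inv]
      linarith
    have h2 : Tendsto ((↑) : ℂ → Sphere) (Bornology.cobounded ℂ) (𝓝 OnePoint.infty) := by
      rw [Metric.cobounded_eq_cocompact, ← Filter.coclosedCompact_eq_cocompact]
      exact OnePoint.tendsto_coe_infty
    refine (h2.comp h1).congr' ?_
    filter_upwards [self_mem_nhdsWithin] with x hx
    rw [mem_compl_iff, mem_singleton_iff] at hx
    simp [hx]
  · have h1 : ContinuousAt (fun v : ℂ => ((a + β / v : ℂ) : Sphere)) v :=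
      OnePoint.continuous_coe.continuousAt.comp
        (continuousAt_const.add (continuousAt_const.div continuousAt_id hv))
    refine h1.congr ?_
    filter_upwards [isOpen_ne.mem_nhds hv] with x hx
    rw [if_neg hx]

/-! ### Montel's theorem for omitted values and normality criteria -/

/-- **Montel's theorem**: a sequence of holomorphic functions on a disc omitting a finite value `a`
and a holomorphic function `b` that does not take the value `a` has a subsequence converging
locally uniformly in the spherical metric near the centre. -/
theorem exists_subseq_tendstoLocallyUniformlyOn_of_omits {u : ℕ → ℂ → ℂ} {c : ℂ} {R : ℝ}
    (hR : 0 < R) (hu : ∀ k, DifferentiableOn ℂ (u k) (ball c R)) {a : ℂ} {b : ℂ → ℂ}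
    (hbd : DifferentiableOn ℂ b (ball c R)) (hab : ∀ z ∈ ball c R, b z ≠ a)
    (ha : ∀ k, ∀ z ∈ ball c R, u k z ≠ a) (hb : ∀ k, ∀ z ∈ ball c R, u k z ≠ b z) :
    ∃ φ : ℕ → ℕ, StrictMono φ ∧ ∃ H : ℂ → Sphere,
      TendstoLocallyUniformlyOn (fun k z => ((u (φ k) z : ℂ) : Sphere)) H atTop
        (ball c (R / 2)) := by
  have hba : ∀ z ∈ ball c R, b z - a ≠ 0 := fun z hz => sub_ne_zero.2 (hab z hz)
  have hua : ∀ k, ∀ z ∈ ball c R, u k z - a ≠ 0 := fun k z hz => sub_ne_zero.2 (ha k z hz)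
  have hsub : ball c (R / 2) ⊆ ball c R := ball_subset_ball (by linarith)
  obtain ⟨C, hC⟩ := exists_bound_of_omits_zero_one 1
  -- `v` is the normalised function `(u - a)/(b - a)` or its reciprocal, both omitting `0` and `1`.
  -- Whichever is bounded by `1` at `c` infinitely often falls under Schottky; the factor `q` undoes
  -- the division by `b - a`.
  have key : ∀ v : ℕ → ℂ → ℂ, ∀ q : ℂ → ℂ, (∀ k, DifferentiableOn ℂ (v k) (ball c R)) →
      (∀ k, ∀ z ∈ ball c R, v k z ≠ 0) → (∀ k, ∀ z ∈ ball c R, v k z ≠ 1) →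
      ContinuousOn q (ball c R) →
      (∃ᶠ k in atTop, ‖v k c‖ ≤ 1) → ∃ φ : ℕ → ℕ, StrictMono φ ∧ ∃ h : ℂ → ℂ,
        ContinuousOn h (ball c (R / 2)) ∧
        TendstoLocallyUniformlyOn (fun k z => q z * v (φ k) z) h atTop (ball c (R / 2)) := by
    intro v q hv h0 h1 hq hfreq
    obtain ⟨ψ, hψ, hψ1⟩ := extraction_of_frequently_atTop hfreq
    obtain ⟨φ, hφ, h, hlim⟩ := exists_subseq_tendstoLocallyUniformlyOn isOpen_ball
      (u := fun k => v (ψ k)) (fun k => (hv (ψ k)).mono hsub) (fun p hp =>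
        ⟨ball c (R / 2), isOpen_ball.mem_nhds hp, C, .of_forall fun k =>
          hC _ c R hR (hv _) (h0 _) (h1 _) (hψ1 k)⟩)
    have hc : ContinuousOn h (ball c (R / 2)) :=
      hlim.continuousOn (Frequently.of_forall fun k => ((hv _).mono hsub).continuousOn)
    refine ⟨ψ ∘ φ, hψ.comp hφ, fun z => q z * h z, (hq.mono hsub).mul hc,
      tendstoLocallyUniformlyOn_of_tendsto_prod_nhds isOpen_ball ((hq.mono hsub).mul hc)
        fun x hx => ?_⟩
    exact (((hq.continuousAt (isOpen_ball.mem_nhds (hsub hx))).tendsto.comp tendsto_snd).mul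
      (hlim.tendsto_prod_nhds isOpen_ball hc hx))
  by_cases hfreq : ∃ᶠ k in atTop, ‖(u k c - a) / (b c - a)‖ ≤ 1
  · obtain ⟨φ, hφ, h, hc, hlim⟩ := key (fun k z => (u k z - a) / (b z - a)) (fun z => b z - a)
      (fun k => ((hu k).sub_const a).div (hbd.sub_const a) hba)
      (fun k z hz => div_ne_zero (hua k z hz) (hba z hz))
      (fun k z hz h => hb k z hz (by
        rw [div_eq_one_iff_eq (hba z hz)] at h
        exact sub_left_injective h)) (hbd.sub_const a).continuousOn hfreq
    have hJ : Continuous fun v : ℂ => ((a + v : ℂ) : Sphere) :=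
      OnePoint.continuous_coe.comp (by fun_prop)
    refine ⟨φ, hφ, _, (hlim.continuous_comp hJ isOpen_ball hc).congr fun k z hz => ?_⟩
    simp only
    rw [mul_div_cancel₀ _ (hba z (hsub hz)), add_sub_cancel]
  · have hfreq' : ∃ᶠ k in atTop, ‖(b c - a) / (u k c - a)‖ ≤ 1 := by
      rw [not_frequently] at hfreq
      refine hfreq.frequently.mono fun k hk => ?_
      rw [← inv_div, norm_inv]
      exact inv_le_one_of_one_le₀ (not_le.1 hk).le
    obtain ⟨φ, hφ, h, hc, hlim⟩ := key (fun k z => (b z - a) / (u k z - a))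
      (fun z => (b z - a)⁻¹)
      (fun k => (hbd.sub_const a).div ((hu k).sub_const a) (hua k))
      (fun k z hz => div_ne_zero (hba z hz) (hua k z hz))
      (fun k z hz h => hb k z hz (by
        rw [div_eq_one_iff_eq (hua k z hz)] at h
        exact (sub_left_injective h).symm)) ((hbd.sub_const a).continuousOn.inv₀ hba) hfreq'
    refine ⟨φ, hφ, _, (hlim.continuous_comp (continuous_add_div_sphere a one_ne_zero) isOpen_ball
      hc).congr fun k z hz => ?_⟩
    have h1 := hua (φ k) z (hsub hz)
    have h2 := hba z (hsub hz)
    have h3 : (b z - a)⁻¹ * ((b z - a) / (u (φ k) z - a)) = (u (φ k) z - a)⁻¹ := by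
      field_simp
    simp only
    rw [h3, if_neg (inv_ne_zero h1), one_div, inv_inv, add_sub_cancel]

/-- To check normality of the iterates, finitely many of them may be ignored. -/
theorem mem_fatouSet_of_exists_subseq {f : ℂ → Sphere} {V : Set ℂ} (hV : IsOpen V) {w : ℂ}
    (hw : w ∈ V) {u : ℕ → ℂ → ℂ} (hiter : ∀ n, ∀ z ∈ V, iter f n z = (u n z : Sphere)) (m : ℕ)
    (H : ∀ s : ℕ → ℕ, (∀ k, m ≤ s k) → ∃ φ : ℕ → ℕ, StrictMono φ ∧ ∃ h : ℂ → Sphere,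
      TendstoLocallyUniformlyOn (fun k z => ((u (s (φ k)) z : ℂ) : Sphere)) h atTop V) :
    w ∈ fatouSet f := by
  refine ⟨V, hV, hw, fun z hz n m _ => ?_, fun s => ?_⟩
  · rw [hiter m z hz]; exact OnePoint.coe_ne_infty _
  -- The sequence `s` is arbitrary: either it repeats some index below `m` infinitely often and has
  -- a constant subsequence, or a tail of it stays above `m`.
  by_cases hfreq : ∃ i < m, ∃ᶠ k in atTop, s k = i
  · obtain ⟨i, -, hi⟩ := hfreq
    obtain ⟨φ, hφ, hφi⟩ := extraction_of_frequently_atTop hi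
    refine ⟨φ, hφ, iter f i, ?_⟩
    simp only [hφi]
    exact fun U hU x hx => ⟨V, self_mem_nhdsWithin, .of_forall fun k y hy => refl_mem_uniformity hU⟩
  · have hev : ∀ᶠ k in atTop, m ≤ s k := by
      have h1 : ∀ i ∈ Finset.range m, ∀ᶠ k in atTop, s k ≠ i := fun i hi => by
        by_contra h
        exact hfreq ⟨i, Finset.mem_range.1 hi, by simpa [Filter.Frequently] using h⟩
      filter_upwards [(eventually_all_finset (Finset.range m)).2 h1] with k hk
      by_contra! hlt
      exact hk (s k) (Finset.mem_range.2 hlt) rfl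
    obtain ⟨k₀, hk₀⟩ := eventually_atTop.1 hev
    obtain ⟨φ, hφ, h, hlim⟩ := H (fun k => s (k + k₀)) (fun k => hk₀ _ (by omega))
    exact ⟨fun k => φ k + k₀, hφ.add_const k₀, h, hlim.congr fun k z hz => (hiter _ z hz).symm⟩

theorem mem_fatouSet_of_omits {f : ℂ → Sphere} {V : Set ℂ} (hV : IsOpen V) {w : ℂ}
    (hw : w ∈ V) {u : ℕ → ℂ → ℂ} (hiter : ∀ n, ∀ z ∈ V, iter f n z = (u n z : Sphere))
    (hu : ∀ n, DifferentiableOn ℂ (u n) V) {a b : ℂ} (hab : a ≠ b)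
    (ha : ∀ n, ∀ z ∈ V, u n z ≠ a) (hb : ∀ n, ∀ z ∈ V, u n z ≠ b) : w ∈ fatouSet f := by
  obtain ⟨R, hR, hball⟩ := Metric.isOpen_iff.1 hV w hw
  have hsub : ball w (R / 2) ⊆ V := (ball_subset_ball (by linarith)).trans hball
  exact mem_fatouSet_of_exists_subseq isOpen_ball (mem_ball_self (by linarith : 0 < R / 2))
    (fun n z hz => hiter n z (hsub hz)) 0 fun s _ =>
      exists_subseq_tendstoLocallyUniformlyOn_of_omits hR (fun k => (hu (s k)).mono hball)
        (differentiableOn_const b) (fun _ _ => hab.symm) (fun k z hz => ha _ z (hball hz)) (fun k z hz => hb _ z (hball hz))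

theorem mem_fatouSet_of_bounded {f : ℂ → Sphere} {V : Set ℂ} (hV : IsOpen V) {w : ℂ}
    (hw : w ∈ V) {u : ℕ → ℂ → ℂ} (hiter : ∀ n, ∀ z ∈ V, iter f n z = (u n z : Sphere))
    (hu : ∀ n, DifferentiableOn ℂ (u n) V) {M : ℝ} (hM : ∀ n, ∀ z ∈ V, ‖u n z‖ ≤ M) :
    w ∈ fatouSet f := by
  refine mem_fatouSet_of_exists_subseq hV hw hiter 0 fun s _ => ?_
  obtain ⟨φ, hφ, h, hlim⟩ := exists_subseq_tendstoLocallyUniformlyOn hV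
    (fun k => hu (s k)) (fun p hp => ⟨V, hV.mem_nhds hp, M, .of_forall fun k => hM (s k)⟩)
  exact ⟨φ, hφ, _, hlim.continuous_comp OnePoint.continuous_coe hV
    (hlim.continuousOn (Frequently.of_forall fun k => (hu _).continuousOn))⟩

/-! ### Meromorphic functions near finite values -/

theorem IsMeromorphicFun.analyticAt_finitePart {f : ℂ → Sphere} (hf : IsMeromorphicFun f) {z : ℂ}
    (hz : f z ≠ OnePoint.infty) : AnalyticAt ℂ (fun x => finitePart (f x)) z := by
  obtain ⟨hc, G, hG, hfG⟩ := hf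
  refine MeromorphicAt.analyticAt ?_ ?_
  · refine (hG z).congr ?_
    filter_upwards [hfG z] with x hx
    rw [hx, finitePart_coe]
  · exact ContinuousAt.comp (f := f) (continuousAt_finitePart hz) hc.continuousAt

/-- The set where `f` is locally equal to `c` is clopen. At a boundary point, even a possible pole,
the zeros of `G - c` are isolated or fill a punctured neighbourhood. -/
theorem IsMeromorphicFun.eq_of_eventually_eq {f : ℂ → Sphere} (hf : IsMeromorphicFun f) {z : ℂ}
    {c : ℂ} (hz : ∀ᶠ x in 𝓝 z, f x = c) : ∀ x, f x = c := by
  obtain ⟨hc, G, hG, hfG⟩ := hf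
  set S := {x | ∀ᶠ y in 𝓝 x, f y = c}
  have hopen : IsOpen S := isOpen_setOfPred_eventually_nhds
  have hclosed : IsClosed S := by
    refine isClosed_of_closure_subset fun x hx => ?_
    have hG' : MeromorphicAt (fun y => G y - c) x := (hG x).sub (MeromorphicAt.const c x)
    have hpunct : ∀ᶠ y in 𝓝[≠] x, f y = c := by
      rcases hG'.eventually_eq_zero_or_eventually_ne_zero with h | h
      · filter_upwards [h, hfG x] with y h1 h2
        rw [h2, sub_eq_zero.1 h1]
      · by_cases hxS : x ∈ S
        · exact hxS.filter_mono nhdsWithin_le_nhds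
        exfalso
        have h1 : ∃ᶠ y in 𝓝[≠] x, y ∈ S := by
          rw [frequently_nhdsWithin_iff]
          refine (mem_closure_iff_frequently.1 hx).mono fun y hy => ⟨hy, ?_⟩
          rintro rfl
          exact hxS hy
        obtain ⟨y, hyS, hy1, hy2⟩ := (h1.and_eventually (h.and (hfG x))).exists
        have h2 : f y = c := hyS.self_of_nhds
        rw [hy2] at h2
        exact hy1 (sub_eq_zero.2 (OnePoint.coe_injective h2))
    have hx : f x = c := by
      have h1 : Tendsto f (𝓝[≠] x) (𝓝 (f x)) := hc.continuousAt.tendsto.mono_left nhdsWithin_le_nhds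
      have h2 : Tendsto f (𝓝[≠] x) (𝓝 (c : Sphere)) :=
        tendsto_const_nhds.congr' (hpunct.mono fun y hy => hy.symm)
      exact tendsto_nhds_unique h1 h2
    rw [eventually_nhdsWithin_iff] at hpunct
    filter_upwards [hpunct] with y hy
    by_cases h : y = x
    · rw [h, hx]
    · exact hy h
  have huniv : S = univ := (IsClopen.eq_univ ⟨hclosed, hopen⟩ ⟨z, hz⟩)
  intro x
  have : x ∈ S := huniv ▸ mem_univ x
  exact this.self_of_nhds

/-- Nonconstant meromorphic functions are open at the points where they are finite. -/
theorem IsMeromorphicFun.nhds_le_map {g : ℂ → Sphere} (hg : IsMeromorphicFun g)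
    (hne : ¬ ∃ c : Sphere, ∀ z, g z = c) {z : ℂ} (hz : g z ≠ OnePoint.infty) :
    𝓝 (finitePart (g z)) ≤ map (fun x => finitePart (g x)) (𝓝 z) := by
  refine (hg.analyticAt_finitePart hz).eventually_constant_or_nhds_le_map_nhds.resolve_left ?_
  intro h
  refine hne ⟨_, hg.eq_of_eventually_eq (z := z) (c := finitePart (g z)) ?_⟩
  have h1 : ∀ᶠ x in 𝓝 z, g x ≠ OnePoint.infty :=
    hg.1.continuousAt.eventually_ne hz
  filter_upwards [h, h1] with x hx hx1
  rw [← hx, coe_finitePart hx1]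

theorem isOpen_fatouSet (f : ℂ → Sphere) : IsOpen (fatouSet f) := by
  rw [isOpen_iff_mem_nhds]
  rintro z ⟨V, hV, hz, h⟩
  filter_upwards [hV.mem_nhds hz] with x hx
  exact ⟨V, hV, hx, h⟩

/-! ### Dynamics of self-maps of the plane and the punctured plane -/

/-- `f` restricts to a holomorphic self-map `F` of the open set `X`. -/
structure IsHolomorphicSelfMap (f : ℂ → Sphere) (F : ℂ → ℂ) (X : Set ℂ) : Prop where
  isOpen : IsOpen X
  coe_eq : ∀ z ∈ X, f z = (F z : Sphere)
  mapsTo : MapsTo F X X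
  differentiableOn : DifferentiableOn ℂ F X

/-- Along the sequence `n`, the iterates of `F` map a neighbourhood of `p` into a compact subset
of `X`. -/
def CompactlyBoundedAt (F : ℂ → ℂ) (X : Set ℂ) (n : ℕ → ℕ) (p : ℂ) : Prop :=
  ∃ N ∈ 𝓝 p, ∃ A : Set ℂ, IsCompact A ∧ A ⊆ X ∧ ∀ᶠ k in atTop, ∀ x ∈ N, F^[n k] x ∈ A

namespace IsHolomorphicSelfMap

variable {f : ℂ → Sphere} {F : ℂ → ℂ} {X : Set ℂ}

theorem mapsTo_iterate (h : IsHolomorphicSelfMap f F X) (n : ℕ) : MapsTo F^[n] X X :=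
  h.mapsTo.iterate n

theorem iter_eq (h : IsHolomorphicSelfMap f F X) (n : ℕ) {z : ℂ} (hz : z ∈ X) :
    iter f n z = (F^[n] z : Sphere) := by
  induction n with
  | zero => rfl
  | succ n ih =>
    rw [iter_succ_eq, ih, sphereExt_coe, h.coe_eq _ (h.mapsTo_iterate n hz),
      Function.iterate_succ_apply']

theorem differentiableOn_iterate (h : IsHolomorphicSelfMap f F X) (n : ℕ) :
    DifferentiableOn ℂ F^[n] X := by
  induction n with
  | zero => exact differentiableOn_id
  | succ n ih =>
    rw [Function.iterate_succ']
    exact h.differentiableOn.comp ih (h.mapsTo_iterate n)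

/-- Writing `m = m % n + n * (m / n)`, every iterate maps `K` into one of the compact sets `F^[i] ''
K` with `i < n`, so the iterates are bounded on `K`. -/
theorem mem_fatouSet_of_mapsTo_compact (h : IsHolomorphicSelfMap f F X) {K : Set ℂ}
    (hK : IsCompact K) (hKX : K ⊆ X) {w : ℂ} (hw : K ∈ 𝓝 w) {n : ℕ} (hn : 0 < n)
    (hm : MapsTo F^[n] K K) : w ∈ fatouSet f := by
  have hcomp : IsCompact (⋃ i ∈ Finset.range n, F^[i] '' K) :=
    (Finset.range n).isCompact_biUnion fun i _ =>
      hK.image_of_continuousOn ((h.differentiableOn_iterate i).continuousOn.mono hKX)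
  obtain ⟨M, hM⟩ := isBounded_iff_forall_norm_le.1 hcomp.isBounded
  have hint : interior K ⊆ X := interior_subset.trans hKX
  refine mem_fatouSet_of_bounded isOpen_interior (mem_interior_iff_mem_nhds.2 hw)
    (fun m z hz => h.iter_eq m (hint hz)) (fun m => (h.differentiableOn_iterate m).mono hint)
    (M := M) fun m z hz => hM _ ?_
  refine mem_biUnion (Finset.mem_coe.2 (Finset.mem_range.2 (Nat.mod_lt m hn)))
    ⟨(F^[n])^[m / n] z, hm.iterate _ (interior_subset hz), ?_⟩
  rw [← Function.iterate_mul, ← Function.iterate_add_apply, Nat.mod_add_div]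

/-- Near a point outside the Fatou set, the iterates omit at most one value. -/
theorem exists_iterate_eq_or_eq (h : IsHolomorphicSelfMap f F X) {w : ℂ} (hw : w ∈ X)
    (hJ : w ∉ fatouSet f) {D : Set ℂ} (hD : D ∈ 𝓝 w) {a b : ℂ} (hab : a ≠ b) :
    ∃ m, ∃ x ∈ D ∩ X, F^[m] x = a ∨ F^[m] x = b := by
  by_contra! hcon
  obtain ⟨V, hVD, hV, hwV⟩ := _root_.mem_nhds_iff.1 (inter_mem hD (h.isOpen.mem_nhds hw))
  have hVX : V ⊆ X := fun x hx => (hVD hx).2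
  exact hJ (mem_fatouSet_of_omits hV hwV (fun n z hz => h.iter_eq n (hVX hz))
    (fun n => (h.differentiableOn_iterate n).mono hVX) hab
    (fun n z hz => (hcon n z (hVD hz)).1) (fun n z hz => (hcon n z (hVD hz)).2))

/-- The Fatou set is backward invariant. -/
theorem mem_fatouSet_of_iterate_mem (h : IsHolomorphicSelfMap f F X) {w : ℂ} (hw : w ∈ X) {m : ℕ}
    (hm : F^[m] w ∈ fatouSet f) : w ∈ fatouSet f := by
  obtain ⟨V, hV, hwV, -, hnorm⟩ := hm
  have hcont : ContinuousOn F^[m] X := (h.differentiableOn_iterate m).continuousOn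
  refine mem_fatouSet_of_exists_subseq (hcont.isOpen_inter_preimage h.isOpen hV) ⟨hw, hwV⟩
    (fun n z hz => h.iter_eq n hz.1) m fun s hs => ?_
  obtain ⟨φ, hφ, H, hlim⟩ := hnorm fun k => s k - m
  refine ⟨φ, hφ, H ∘ F^[m], (hlim.comp F^[m] (t := X ∩ F^[m] ⁻¹' V) (fun z hz => hz.2)
    (hcont.mono inter_subset_left)).congr fun k z hz => ?_⟩
  simp only [Function.comp_apply]
  rw [h.iter_eq _ (h.mapsTo_iterate m hz.1), ← Function.iterate_add_apply,
    Nat.sub_add_cancel (hs _)]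

theorem mem_fatouSet_of_const (h : IsHolomorphicSelfMap f F X) {c : ℂ} (hc : ∀ z ∈ X, F z = c)
    {w : ℂ} (hw : w ∈ X) : w ∈ fatouSet f := by
  obtain ⟨K, hKw, hKX, hK⟩ := local_compact_nhds (h.isOpen.mem_nhds hw)
  have hcX : c ∈ X := hc w hw ▸ h.mapsTo hw
  refine h.mem_fatouSet_of_mapsTo_compact (hK.union isCompact_singleton)
    (union_subset hKX (singleton_subset_iff.2 hcX)) (mem_of_superset hKw subset_union_left)
    one_pos fun z hz => ?_
  rcases hz with hz | hz
  · exact Or.inr (hc z (hKX hz))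
  · exact Or.inr (hc z (by rw [mem_singleton_iff.1 hz]; exact hcX))

theorem nhds_le_map_iterate (h : IsHolomorphicSelfMap f F X) (hXc : IsPreconnected X)
    (hne : ¬ ∃ c, ∀ z ∈ X, F z = c) (m : ℕ) {x : ℂ} (hx : x ∈ X) :
    𝓝 (F^[m] x) ≤ map F^[m] (𝓝 x) := by
  have h1 : ∀ y ∈ X, 𝓝 (F y) ≤ map F (𝓝 y) := by
    intro y hy
    have han := h.differentiableOn.analyticOnNhd h.isOpen
    refine (han y hy).eventually_constant_or_nhds_le_map_nhds.resolve_left fun hc => hne ⟨F y, ?_⟩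
    exact han.eqOn_of_preconnected_of_eventuallyEq analyticOnNhd_const hXc hy hc
  induction m with
  | zero => simp
  | succ m ih =>
    rw [Function.iterate_succ', ← map_map]
    exact (h1 _ (h.mapsTo_iterate m hx)).trans (map_mono ih)

/-- Compact boundedness spreads from one point outside the Fatou set to all of `X`. -/
theorem compactlyBoundedAt_of_notMem (h : IsHolomorphicSelfMap f F X)
    (hX : X = univ ∨ ∃ a, X = {a}ᶜ) (hXc : IsPreconnected X) {n : ℕ → ℕ} {w : ℂ} (hw : w ∈ X)
    (hJ : w ∉ fatouSet f) (hb : CompactlyBoundedAt F X n w) :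
    ∀ p ∈ X, CompactlyBoundedAt F X n p := by
  have hne : ¬ ∃ c, ∀ z ∈ X, F z = c := fun ⟨c, hc⟩ => hJ (h.mem_fatouSet_of_const hc hw)
  obtain ⟨N, hN, A, hA, hAX, hNA⟩ := hb
  -- Boundedness is transported forward along orbits, since `F^[n k]` commutes with `F^[m]` and
  -- `F^[m]` is open.
  have hstep : ∀ m, ∀ x ∈ interior N ∩ X, CompactlyBoundedAt F X n (F^[m] x) := by
    rintro m x ⟨hxN, hxX⟩
    refine ⟨F^[m] '' N, h.nhds_le_map_iterate hXc hne m hxX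
      (image_mem_map (mem_interior_iff_mem_nhds.1 hxN)), F^[m] '' A,
      hA.image_of_continuousOn ((h.differentiableOn_iterate m).continuousOn.mono hAX),
      ((h.mapsTo_iterate m).mono_left hAX).image_subset, ?_⟩
    filter_upwards [hNA] with k hk
    rintro _ ⟨y, hy, rfl⟩
    exact ⟨_, hk y hy, by rw [← Function.iterate_add_apply, ← Function.iterate_add_apply, add_comm]⟩
  -- The orbit of a neighbourhood of `w` misses at most one point of `ℂ`. For the punctured plane
  -- that point is the puncture; for the plane, the maximum principle on a circle around it settles
  -- the exceptional point.
  have hpair : ∀ a b : ℂ, a ≠ b →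
      (a ∈ X ∧ CompactlyBoundedAt F X n a) ∨ (b ∈ X ∧ CompactlyBoundedAt F X n b) := by
    intro a b hab
    obtain ⟨m, x, hx, hxm⟩ := h.exists_iterate_eq_or_eq hw hJ (interior_mem_nhds.2 hN) hab
    rcases hxm with rfl | rfl
    · exact Or.inl ⟨h.mapsTo_iterate m hx.2, hstep m x hx⟩
    · exact Or.inr ⟨h.mapsTo_iterate m hx.2, hstep m x hx⟩
  intro p hp
  rcases hX with rfl | ⟨a, rfl⟩
  · by_contra hcon
    have hsph : ∀ x ∈ sphere p 1, CompactlyBoundedAt F univ n x := by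
      intro x hx
      rcases hpair p x (ne_of_mem_sphere hx one_ne_zero).symm with h1 | h1
      · exact absurd h1.2 hcon
      · exact h1.2
    have hbd : ∃ M : ℝ, ∀ᶠ k in atTop, ∀ x ∈ sphere p 1, ‖F^[n k] x‖ ≤ M := by
      refine (isCompact_sphere p 1).induction_on
        (p := fun s => ∃ M : ℝ, ∀ᶠ k in atTop, ∀ x ∈ s, ‖F^[n k] x‖ ≤ M) ?_ ?_ ?_ ?_
      · exact ⟨0, by simp⟩
      · rintro s t hst ⟨M, hM⟩
        exact ⟨M, hM.mono fun k hk x hx => hk x (hst hx)⟩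
      · rintro s t ⟨M, hM⟩ ⟨M', hM'⟩
        refine ⟨max M M', ?_⟩
        filter_upwards [hM, hM'] with k h1 h2
        rintro x (hx | hx)
        · exact le_max_of_le_left (h1 x hx)
        · exact le_max_of_le_right (h2 x hx)
      · intro x hx
        obtain ⟨N', hN', A', hA', -, hb'⟩ := hsph x hx
        obtain ⟨M, hM⟩ := isBounded_iff_forall_norm_le.1 hA'.isBounded
        exact ⟨N', mem_nhdsWithin_of_mem_nhds hN', M, hb'.mono fun k hk y hy => hM _ (hk y hy)⟩
    obtain ⟨M, hM⟩ := hbd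
    refine hcon ⟨closedBall p 1, closedBall_mem_nhds p one_pos, closedBall 0 M,
      isCompact_closedBall _ _, subset_univ _, ?_⟩
    filter_upwards [hM] with k hk x hx
    rw [mem_closedBall_zero_iff]
    have hd : Differentiable ℂ F^[n k] := differentiableOn_univ.1 (h.differentiableOn_iterate _)
    refine Complex.norm_le_of_forall_mem_frontier_norm_le (U := ball p 1) isBounded_ball
      hd.diffContOnCl (fun z hz => hk z ?_) (by rwa [closure_ball p one_ne_zero])
    rwa [frontier_ball p one_ne_zero] at hz
  · rcases hpair a p (by rintro rfl; exact hp rfl) with h1 | h1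
    · exact absurd rfl h1.1
    · exact h1.2

/-- Compactness of `A` inside `X`, rather than mere boundedness, keeps the values of the limit in
`X`. -/
theorem exists_subseq_of_compactlyBoundedAt (h : IsHolomorphicSelfMap f F X) {n : ℕ → ℕ}
    (hb : ∀ p ∈ X, CompactlyBoundedAt F X n p) :
    ∃ φ : ℕ → ℕ, StrictMono φ ∧ ∃ H : ℂ → ℂ, MapsTo H X X ∧ DifferentiableOn ℂ H X ∧
      TendstoLocallyUniformlyOn (fun k => F^[n (φ k)]) H atTop X := by
  obtain ⟨φ, hφ, H, hlim⟩ := exists_subseq_tendstoLocallyUniformlyOn h.isOpen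
    (u := fun k => F^[n k]) (fun k => h.differentiableOn_iterate _) (fun p hp => by
      obtain ⟨N, hN, A, hA, -, hNA⟩ := hb p hp
      obtain ⟨M, hM⟩ := isBounded_iff_forall_norm_le.1 hA.isBounded
      exact ⟨N, hN, M, hNA.mono fun k hk x hx => hM _ (hk x hx)⟩)
  refine ⟨φ, hφ, H, fun p hp => ?_, hlim.differentiableOn
    (.of_forall fun k => h.differentiableOn_iterate _) h.isOpen, hlim⟩
  obtain ⟨N, hN, A, hA, hAX, hNA⟩ := hb p hp
  refine hAX (hA.isClosed.mem_of_tendsto (hlim.tendsto_at hp) ?_)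
  filter_upwards [hφ.tendsto_atTop.eventually hNA] with k hk
  exact hk p (mem_of_mem_nhds hN)

/-- If some iterates of an entire function tend to the identity, every point is a Fatou point. -/
theorem mem_fatouSet_of_tendsto_id_univ (h : IsHolomorphicSelfMap f F univ) {m : ℕ → ℕ}
    (hm : ∀ k, 0 < m k) (hinj : Function.Injective F)
    (hlim : ∀ z, Tendsto (fun k => F^[m k] z) atTop (𝓝 z)) (w : ℂ) : w ∈ fatouSet f := by
  obtain ⟨α, β, hF⟩ := exists_eq_mul_add_of_injective (differentiableOn_univ.1 h.differentiableOn)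
    hinj
  obtain ⟨p, hp⟩ : ∃ p, F p = p := by
    rcases eq_or_ne α 1 with rfl | hα
    · have hit : ∀ n : ℕ, F^[n] 0 = n * β := by
        intro n
        induction n with
        | zero => simp
        | succ n ih => rw [Function.iterate_succ_apply', ih, hF]; push_cast; ring
      have h1 : Tendsto (fun k => ‖F^[m k] 0‖) atTop (𝓝 ‖(0 : ℂ)‖) := (hlim 0).norm
      have h2 : ‖β‖ ≤ ‖(0 : ℂ)‖ := ge_of_tendsto' h1 fun k => by
        rw [hit, norm_mul, Complex.norm_natCast]
        have : (1 : ℝ) ≤ m k := by exact_mod_cast hm k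
        nlinarith [norm_nonneg β]
      have h3 : β = 0 := by simpa using h2
      exact ⟨0, by rw [hF, h3]; ring⟩
    · have : 1 - α ≠ 0 := sub_ne_zero.2 hα.symm
      exact ⟨β / (1 - α), by rw [hF]; field_simp; ring⟩
  -- About the fixed point `p`, `F` is multiplication by `α`. Convergence to the identity forces
  -- `‖α‖ ≤ 1`, so discs about `p` are mapped into themselves.
  have hsub : ∀ z, F z - p = α * (z - p) := fun z => by
    have := hF p
    rw [hp] at this
    rw [hF]; linear_combination -this
  have hit : ∀ (n : ℕ) z, F^[n] z - p = α ^ n * (z - p) := by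
    intro n z
    induction n with
    | zero => simp
    | succ n ih => rw [Function.iterate_succ_apply', hsub, ih]; ring
  have hα : ‖α‖ ≤ 1 := by
    by_contra! hα
    have h1 : Tendsto (fun k => ‖F^[m k] (p + 1) - p‖) atTop (𝓝 ‖p + 1 - p‖) :=
      ((hlim (p + 1)).sub_const p).norm
    have h2 : ‖α‖ ≤ ‖p + 1 - p‖ := ge_of_tendsto' h1 fun k => by
      rw [hit, add_sub_cancel_left, mul_one, norm_pow]
      exact le_self_pow₀ hα.le (hm k).ne'
    rw [add_sub_cancel_left, norm_one] at h2
    linarith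
  refine h.mem_fatouSet_of_mapsTo_compact (isCompact_closedBall p (dist w p + 1)) (subset_univ _)
    (closedBall_mem_nhds_of_mem (by rw [mem_ball]; linarith)) one_pos fun z hz => ?_
  rw [mem_closedBall, dist_eq_norm] at hz ⊢
  rw [Function.iterate_one, hsub, norm_mul]
  nlinarith [norm_nonneg (z - p), norm_nonneg α]

/-- An injective holomorphic self-map of the punctured plane with a pole at the puncture is an
involution, and all points are Fatou points. -/
theorem mem_fatouSet_of_injOn_compl_singleton {a : ℂ} (h : IsHolomorphicSelfMap f F {a}ᶜ)
    (ha : Tendsto F (𝓝[≠] a) (Bornology.cobounded ℂ)) (hinj : InjOn F {a}ᶜ) {w : ℂ}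
    (hw : w ∈ ({a}ᶜ : Set ℂ)) : w ∈ fatouSet f := by
  classical
  have hFa : ∀ z, z ≠ a → F z - a ≠ 0 := fun z hz => sub_ne_zero.2 (h.mapsTo hz)
  -- The pole at `a` makes the value `0` a continuous extension, so `G` is entire and injective,
  -- hence affine. This gives `F z = a + 1 / (α (z - a))`.
  set G : ℂ → ℂ := fun z => if z = a then 0 else (F z - a)⁻¹ with hG
  have hGne : ∀ z, z ≠ a → G z = (F z - a)⁻¹ := fun z hz => if_neg hz
  have hGa : G a = 0 := if_pos rfl
  have hGcont : ContinuousAt G a := by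
    rw [continuousAt_iff_punctured_nhds, hGa]
    have h1 : Tendsto (fun z => F z - a) (𝓝[≠] a) (Bornology.cobounded ℂ) := by
      simpa [sub_eq_add_neg] using! (tendsto_add_const_cobounded (-a)).comp ha
    refine (tendsto_inv₀_cobounded.comp h1).congr' ?_
    filter_upwards [self_mem_nhdsWithin] with z hz
    exact (hGne z hz).symm
  have hGd : Differentiable ℂ G := by
    rw [← differentiableOn_univ,
      ← Complex.differentiableOn_compl_singleton_and_continuousAt_iff (univ_mem : univ ∈ 𝓝 a)]
    refine ⟨DifferentiableOn.congr (f := fun z => (F z - a)⁻¹) ?_ fun z hz => hGne z hz.2, hGcont⟩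
    exact ((h.differentiableOn.sub_const a).inv hFa).mono fun z hz => hz.2
  have hGinj : Function.Injective G := by
    have h0 : ∀ z, z ≠ a → G z ≠ 0 := fun z hz => by
      rw [hGne z hz]; exact inv_ne_zero (hFa z hz)
    intro x y hxy
    by_cases hx : x = a <;> by_cases hy : y = a
    · rw [hx, hy]
    · rw [hx, hGa] at hxy; exact absurd hxy.symm (h0 y hy)
    · rw [hy, hGa] at hxy; exact absurd hxy (h0 x hx)
    · rw [hGne x hx, hGne y hy, inv_inj] at hxy
      exact hinj hx hy (sub_left_injective hxy)
  obtain ⟨α, β, hαβ⟩ := exists_eq_mul_add_of_injective hGd hGinj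
  have hβ : β = -(α * a) := by
    have := hαβ a
    rw [hGa] at this
    linear_combination -this
  have hF : ∀ z, z ≠ a → F z - a = (α * (z - a))⁻¹ := by
    intro z hz
    rw [← inv_inv (F z - a), ← hGne z hz, hαβ, hβ]
    ring
  have hinv : ∀ z, z ≠ a → F (F z) = z := by
    intro z hz
    have h1 := hF (F z) (h.mapsTo hz)
    have h2 := hF z hz
    have hα : α ≠ 0 := by
      rintro rfl
      exact hFa z hz (by rw [h2]; simp)
    have hz' := sub_ne_zero.2 hz
    rw [h2] at h1
    field_simp at h1
    linear_combination h1
  obtain ⟨K, hKw, hKX, hK⟩ := local_compact_nhds (h.isOpen.mem_nhds hw)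
  refine h.mem_fatouSet_of_mapsTo_compact hK hKX hKw two_pos fun z hz => ?_
  change F (F z) ∈ K
  rwa [hinv z (hKX hz)]

/-- Outside the Fatou set, no subsequence of the iterates is compactly bounded. -/
theorem not_compactlyBoundedAt_of_notMem (h : IsHolomorphicSelfMap f F X)
    (hX : X = univ ∨ ∃ a, X = {a}ᶜ ∧ Tendsto F (𝓝[≠] a) (Bornology.cobounded ℂ))
    {n : ℕ → ℕ} (hn : StrictMono n) {w : ℂ} (hw : w ∈ X) (hJ : w ∉ fatouSet f) :
    ¬ CompactlyBoundedAt F X n w := by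
  intro hb
  have hX' : X = univ ∨ ∃ a, X = {a}ᶜ := hX.imp_right fun ⟨a, ha, _⟩ => ⟨a, ha⟩
  have hXc : IsPreconnected X := by
    rcases hX' with rfl | ⟨a, rfl⟩
    · exact isPreconnected_univ
    · exact (isConnected_compl_singleton_of_one_lt_rank
        (by rw [Complex.rank_real_complex]; norm_num) a).isPreconnected
  obtain ⟨φ, hφ, H, hHX, hHd, hlim⟩ := h.exists_subseq_of_compactlyBoundedAt
    (h.compactlyBoundedAt_of_notMem hX' hXc hw hJ hb)
  set n' := n ∘ φ with hn'_def
  have hn' : StrictMono n' := hn.comp hφ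
  have hHan := hHd.analyticOnNhd h.isOpen
  by_cases hconst : ∀ᶠ z in 𝓝 w, H z = H w
  · have hHc : EqOn H (fun _ => H w) X :=
      hHan.eqOn_of_preconnected_of_eventuallyEq analyticOnNhd_const hXc hw hconst
    obtain ⟨K₁, hK₁w, hK₁X, hK₁⟩ := local_compact_nhds (h.isOpen.mem_nhds hw)
    obtain ⟨K₂, hK₂w, hK₂X, hK₂⟩ := local_compact_nhds (h.isOpen.mem_nhds (hHX hw))
    obtain ⟨ε, hε, hball⟩ := Metric.mem_nhds_iff.1 hK₂w
    have hunif := (tendstoLocallyUniformlyOn_iff_forall_isCompact h.isOpen).1 hlim _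
      (union_subset hK₁X hK₂X) (hK₁.union hK₂)
    obtain ⟨k, hk, hk0⟩ := ((Metric.tendstoUniformlyOn_iff.1 hunif ε hε).and
      (hn'.tendsto_atTop.eventually_gt_atTop 0)).exists
    refine hJ (h.mem_fatouSet_of_mapsTo_compact (hK₁.union hK₂) (union_subset hK₁X hK₂X)
      (mem_of_superset hK₁w subset_union_left) hk0 fun z hz => Or.inr (hball ?_))
    have h1 := hk z hz
    rw [hHc (union_subset hK₁X hK₂X hz)] at h1
    rwa [mem_ball, dist_comm]
  · have hqJ : H w ∉ fatouSet f := by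
      intro hq
      obtain ⟨k, hk⟩ := ((hlim.tendsto_at hw).eventually
        ((isOpen_fatouSet f).mem_nhds hq)).exists
      exact hJ (h.mem_fatouSet_of_iterate_mem hw hk)
    -- The differences need not increase; only their positivity is used.
    set l : ℕ → ℕ := fun k => n' (k + 1) - n' k with hl
    have hl0 : ∀ k, 0 < l k := fun k => Nat.sub_pos_of_lt (hn' (Nat.lt_succ_self k))
    have hcomp : ∀ k x, F^[l k] (F^[n' k] x) = F^[n' (k + 1)] x := fun k x => by
      rw [← Function.iterate_add_apply, hl, Nat.sub_add_cancel (hn' (Nat.lt_succ_self k)).le]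
    have hlb : CompactlyBoundedAt F X l (H w) := by
      obtain ⟨N, hN, A, hA, hAX, hNA⟩ := hb
      -- By Hurwitz, each point of a fixed disc about `H w` is `F^[n' k] x` with `x ∈ N`, and `F^[l
      -- k]` sends it to `F^[n' (k + 1)] x ∈ A`.
      obtain ⟨ε, hε, himg⟩ := exists_ball_subset_image_of_tendstoLocallyUniformlyOn h.isOpen
        (fun k => h.differentiableOn_iterate _) hlim hw hconst hN
      refine ⟨ball (H w) ε, ball_mem_nhds _ hε, A, hA, hAX, ?_⟩
      filter_upwards [himg, (hφ.tendsto_atTop.comp (tendsto_add_atTop_nat 1)).eventually hNA]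
        with k h1 h2 y hy
      obtain ⟨x, hx, rfl⟩ := h1 hy
      change F^[l k] (F^[n' k] x) ∈ A
      rw [hcomp]
      exact h2 x hx
    obtain ⟨ψ, hψ, H', -, hH'd, hlim'⟩ := h.exists_subseq_of_compactlyBoundedAt
      (h.compactlyBoundedAt_of_notMem hX' hXc (hHX hw) hqJ hlb)
    have hfix : ∀ x ∈ X, H' (H x) = H x := by
      intro x hx
      have h1 : Tendsto (fun k => F^[n' (ψ k)] x) atTop (𝓝 (H x)) :=
        (hlim.tendsto_at hx).comp hψ.tendsto_atTop
      have h2 : Tendsto (fun k => F^[n' (ψ k + 1)] x) atTop (𝓝 (H x)) :=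
        (hlim.tendsto_at hx).comp ((tendsto_add_atTop_nat 1).comp hψ.tendsto_atTop)
      have h3 : Tendsto (fun k => F^[l (ψ k)] (F^[n' (ψ k)] x)) atTop (𝓝 (H' (H x))) :=
        (hlim'.tendsto_prod_nhds h.isOpen hH'd.continuousOn (hHX hx)).comp
          (tendsto_id.prodMk h1)
      simp only [hcomp] at h3
      exact tendsto_nhds_unique h3 h2
    have hid : EqOn H' id X := by
      refine (hH'd.analyticOnNhd h.isOpen).eqOn_of_preconnected_of_eventuallyEq
        analyticOnNhd_id hXc (hHX hw) ?_
      have h1 : 𝓝 (H w) ≤ map H (𝓝 w) :=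
        (hHan w hw).eventually_constant_or_nhds_le_map_nhds.resolve_left hconst
      refine h1 ?_
      rw [mem_map]
      filter_upwards [h.isOpen.mem_nhds hw] with x hx
      exact hfix x hx
    have hlim'' : ∀ z ∈ X, Tendsto (fun k => F^[l (ψ k)] z) atTop (𝓝 z) := fun z hz => by
      have := hlim'.tendsto_at hz
      rwa [hid hz] at this
    -- If `F x = F y`, all iterates of positive order agree at `x` and `y`, and along `l ∘ ψ` they
    -- tend to `x` and `y`.
    have hinj : InjOn F X := by
      intro x hx y hy hxy
      refine tendsto_nhds_unique (hlim'' x hx) ((hlim'' y hy).congr fun k => ?_)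
      obtain ⟨j, hj⟩ := Nat.exists_eq_succ_of_ne_zero (hl0 (ψ k)).ne'
      rw [hj, Function.iterate_succ_apply, Function.iterate_succ_apply, hxy]
    rcases hX with rfl | ⟨a, rfl, ha⟩
    · exact hJ (h.mem_fatouSet_of_tendsto_id_univ (fun k => hl0 (ψ k)) (injOn_univ.1 hinj)
        (fun z => hlim'' z (mem_univ z)) w)
    · exact hJ (h.mem_fatouSet_of_injOn_compl_singleton ha hinj hw)

/-- For a self-map of the punctured plane, periodic points accumulate at every point outside the
Fatou set. -/
theorem exists_periodic_of_notMem {a : ℂ} (h : IsHolomorphicSelfMap f F {a}ᶜ) {w : ℂ}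
    (hw : w ∈ ({a}ᶜ : Set ℂ)) (hJ : w ∉ fatouSet f) {D : Set ℂ} (hD : D ∈ 𝓝 w) :
    ∃ p ∈ D, ∃ m, 0 < m ∧ F^[m] p = p := by
  by_contra! hcon
  obtain ⟨R, hR, hball⟩ := Metric.mem_nhds_iff.1 (inter_mem hD (h.isOpen.mem_nhds hw))
  have hBX : ball w R ⊆ {a}ᶜ := fun x hx => (hball hx).2
  have hsub : ball w (R / 2) ⊆ ball w R := ball_subset_ball (by linarith)
  -- Montel with omitted values `a` and the identity. The index `1` discards the zeroth iterate,
  -- which is the identity itself.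
  exact hJ (mem_fatouSet_of_exists_subseq isOpen_ball (mem_ball_self (by linarith : 0 < R / 2))
    (fun n z hz => h.iter_eq n (hBX (hsub hz))) 1 fun s hs =>
      exists_subseq_tendstoLocallyUniformlyOn_of_omits hR
        (fun k => (h.differentiableOn_iterate (s k)).mono hBX) differentiableOn_id
        (fun z hz => hBX hz) (fun k z hz => h.mapsTo_iterate _ (hBX hz))
        (fun k z hz => hcon z (hball hz).1 (s k) (hs k)))

end IsHolomorphicSelfMap

/-! ### Prepoles and commutation -/

/-- The points at which some iterate of `f` takes the value `∞`: the iterated preimages of `∞`. -/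
def prepoleSet (f : ℂ → Sphere) : Set ℂ := {z | ∃ n, iter f n z = OnePoint.infty}

theorem iter_add_of_iter_eq {f : ℂ → Sphere} {m : ℕ} {z y : ℂ} (h : iter f m z = (y : Sphere))
    (n : ℕ) : iter f (n + m) z = iter f n y := by
  rw [iter, Function.iterate_add_apply]
  exact congrArg _ h

theorem notMem_prepoleSet_of_iter_eq {f : ℂ → Sphere} {m : ℕ} {z y : ℂ} (hz : z ∉ prepoleSet f)
    (h : iter f m z = (y : Sphere)) : y ∉ prepoleSet f :=
  fun ⟨n, hn⟩ => hz ⟨n + m, (iter_add_of_iter_eq h n).trans hn⟩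

theorem apply_ne_infty_of_notMem_prepoleSet {f : ℂ → Sphere} {z : ℂ} (hz : z ∉ prepoleSet f) :
    f z ≠ OnePoint.infty := fun h => hz ⟨1, h⟩

theorem CommutingFun.apply_eq_infty_iff {f g : ℂ → Sphere} (hfg : CommutingFun f g) (z : ℂ) :
    f z = OnePoint.infty ↔ g z = OnePoint.infty := by
  rcases hfg z with h | h
  · exact ⟨fun h' => absurd h' h.2.1, fun h' => absurd h' h.1⟩
  · exact ⟨fun _ => h.1, fun _ => h.2⟩

/-- `g` intertwines the orbits of `f`. -/
theorem CommutingFun.iter_finitePart {f g : ℂ → Sphere} (hfg : CommutingFun f g) {z : ℂ}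
    (hz : z ∉ prepoleSet f) (n : ℕ) :
    iter f n (finitePart (g z)) = g (finitePart (iter f n z)) := by
  have hfin : ∀ {y : ℂ}, y ∉ prepoleSet f → g y ≠ OnePoint.infty := fun hy h =>
    apply_ne_infty_of_notMem_prepoleSet hy ((hfg.apply_eq_infty_iff _).2 h)
  induction n with
  | zero => simpa using coe_finitePart (hfin hz)
  | succ n ih =>
    obtain ⟨y, hy⟩ := OnePoint.ne_infty_iff_exists.1 fun h => hz ⟨n, h⟩
    rw [iter_succ_eq, ih, iter_succ_eq, ← hy, finitePart_coe, sphereExt_coe]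
    have hyf := notMem_prepoleSet_of_iter_eq hz hy.symm
    rcases hfg y with h | h
    · rw [h.2.2, ← coe_finitePart h.2.1, sphereExt_coe, finitePart_coe]
    · exact absurd h.1 (hfin hyf)

/-- If the orbit of `g z` reached `∞` at time `n`, then `g`, and with it `f`, would have a pole at
`fⁿ z`, making `z` a prepole. -/
theorem CommutingFun.finitePart_notMem_prepoleSet {f g : ℂ → Sphere} (hfg : CommutingFun f g)
    {z : ℂ} (hz : z ∉ prepoleSet f) : finitePart (g z) ∉ prepoleSet f := by
  rintro ⟨n, hn⟩
  rw [hfg.iter_finitePart hz, ← hfg.apply_eq_infty_iff] at hn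
  obtain ⟨y, hy⟩ := OnePoint.ne_infty_iff_exists.1 fun h => hz ⟨n, h⟩
  rw [← hy, finitePart_coe] at hn
  exact apply_ne_infty_of_notMem_prepoleSet (notMem_prepoleSet_of_iter_eq hz hy.symm) hn

theorem IsMeromorphicFun.differentiableOn_iter {f : ℂ → Sphere} (hf : IsMeromorphicFun f)
    {V : Set ℂ} (hV : V ⊆ (prepoleSet f)ᶜ) (n : ℕ) :
    DifferentiableOn ℂ (fun z => finitePart (iter f n z)) V := by
  induction n with
  | zero => exact differentiableOn_id
  | succ n ih =>
    intro z hz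
    obtain ⟨y, hy⟩ := OnePoint.ne_infty_iff_exists.1 fun h => hV hz ⟨n, h⟩
    have h1 : DifferentiableAt ℂ (fun x => finitePart (f x)) (finitePart (iter f n z)) := by
      rw [← hy, finitePart_coe]
      exact (hf.analyticAt_finitePart (apply_ne_infty_of_notMem_prepoleSet
        (notMem_prepoleSet_of_iter_eq (hV hz) hy.symm))).differentiableAt
    have h2 : ∀ x ∈ V, finitePart (iter f (n + 1) x) =
        ((fun x => finitePart (f x)) ∘ fun x => finitePart (iter f n x)) x := fun x hx => ?_
    · exact (h1.comp_differentiableWithinAt z (ih z hz)).congr h2 (h2 z hz)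
    rw [Function.comp_apply, iter_succ_eq, ← sphereExt_coe f (finitePart _),
      coe_finitePart fun h => hV hx ⟨n, h⟩]

/-- If `∞` has at least two iterated preimages in the plane, then every point with a neighbourhood
on which all iterates are finite is a Fatou point. -/
theorem IsMeromorphicFun.mem_fatouSet_of_not_subsingleton {f : ℂ → Sphere}
    (hf : IsMeromorphicFun f) (hE : ¬ (prepoleSet f).Subsingleton) {w : ℂ}
    (hw : (prepoleSet f)ᶜ ∈ 𝓝 w) : w ∈ fatouSet f := by
  obtain ⟨a, ha, b, hb, hab⟩ := Set.not_subsingleton_iff.1 hE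
  obtain ⟨V, hVE, hV, hwV⟩ := _root_.mem_nhds_iff.1 hw
  have hiter : ∀ n, ∀ z ∈ V, iter f n z = (finitePart (iter f n z) : Sphere) := fun n z hz =>
    (coe_finitePart fun h => hVE hz ⟨n, h⟩).symm
  refine mem_fatouSet_of_omits hV hwV hiter (hf.differentiableOn_iter hVE) hab ?_ ?_
  · rintro n z hz rfl
    exact notMem_prepoleSet_of_iter_eq (hVE hz) (hiter n z hz) ha
  · rintro n z hz rfl
    exact notMem_prepoleSet_of_iter_eq (hVE hz) (hiter n z hz) hb

theorem IsMeromorphicFun.isHolomorphicSelfMap {f : ℂ → Sphere} (hf : IsMeromorphicFun f)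
    (hE : IsClosed (prepoleSet f)) :
    IsHolomorphicSelfMap f (fun z => finitePart (f z)) (prepoleSet f)ᶜ where
  isOpen := hE.isOpen_compl
  coe_eq _ hz := (coe_finitePart (apply_ne_infty_of_notMem_prepoleSet hz)).symm
  mapsTo _ hz := notMem_prepoleSet_of_iter_eq (m := 1) hz
    (coe_finitePart (apply_ne_infty_of_notMem_prepoleSet hz)).symm
  differentiableOn _ hz := (hf.analyticAt_finitePart
    (apply_ne_infty_of_notMem_prepoleSet hz)).differentiableAt.differentiableWithinAt

/-- A finite `f a` would again be a prepole, so equal to `a`; a fixed point never reaches `∞`. -/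
theorem apply_eq_infty_of_prepoleSet_eq_singleton {f : ℂ → Sphere} {a : ℂ}
    (hE : prepoleSet f = {a}) : f a = OnePoint.infty := by
  by_contra hne
  obtain ⟨y, hy⟩ := OnePoint.ne_infty_iff_exists.1 hne
  have haE : a ∈ prepoleSet f := hE ▸ mem_singleton a
  have h1 : iter f 1 a = (y : Sphere) := hy.symm
  have hyE : y ∈ prepoleSet f := by
    obtain ⟨n, hn⟩ := haE
    cases n with
    | zero => exact absurd hn (OnePoint.coe_ne_infty a)
    | succ n => exact ⟨n, (iter_add_of_iter_eq h1 n).symm.trans hn⟩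
  obtain rfl : y = a := by rw [hE] at hyE; exact hyE
  have hall : ∀ n, iter f n y = (y : Sphere) := by
    intro n
    induction n with
    | zero => rfl
    | succ n ih => rw [iter_add_of_iter_eq h1 n, ih]
  obtain ⟨n, hn⟩ := haE
  rw [hall n] at hn
  exact OnePoint.coe_ne_infty y hn

theorem IsMeromorphicFun.tendsto_cobounded {f : ℂ → Sphere} (hf : IsMeromorphicFun f) {a : ℂ}
    (ha : f a = OnePoint.infty) (hE : ∀ z, z ≠ a → f z ≠ OnePoint.infty) :
    Tendsto (fun z => finitePart (f z)) (𝓝[≠] a) (Bornology.cobounded ℂ) := by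
  rw [Metric.cobounded_eq_cocompact, ← Filter.coclosedCompact_eq_cocompact,
    ← OnePoint.comap_coe_nhds_infty, tendsto_comap_iff, ← ha]
  refine (hf.1.continuousAt.tendsto.mono_left nhdsWithin_le_nhds).congr' ?_
  filter_upwards [self_mem_nhdsWithin] with z hz
  exact (coe_finitePart (hE z hz)).symm

theorem fatouSet_subset_compl_prepoleSet (f : ℂ → Sphere) : fatouSet f ⊆ (prepoleSet f)ᶜ := by
  rintro z ⟨V, -, hz, hdef, -⟩ ⟨n, hn⟩
  exact hdef z hz (n + 1) n (Nat.lt_succ_self n) hn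

/-! ### The main theorem -/

theorem theorem1p1 (f g : ℂ → Sphere) (hf : IsMeromorphicFun f) (hg : IsMeromorphicFun g)
    (hg_nonconst : ¬ ∃ c : Sphere, ∀ z, g z = c) (hfg : CommutingFun f g)
    (U : Set ℂ) (hU : IsFatouComponent f U)
    (hlim : ∃ n : ℕ → ℕ, StrictMono n ∧ ∃ φ : ℂ → ℂ,
      TendstoLocallyUniformlyOn (fun k => iter f (n k)) (fun z => ((φ z : ℂ) : Sphere)) atTop U) :
    g '' U ⊆ ((↑) : ℂ → Sphere) '' fatouSet f := by
  obtain ⟨n, hn, φ, hφ⟩ := hlim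
  have hUo : IsOpen U := by
    obtain ⟨z, -, rfl⟩ := hU
    exact (isOpen_fatouSet f).connectedComponentIn
  have hUE : U ⊆ (prepoleSet f)ᶜ := by
    obtain ⟨z, -, rfl⟩ := hU
    exact (connectedComponentIn_subset _ _).trans (fatouSet_subset_compl_prepoleSet f)
  rintro _ ⟨z₀, hz₀, rfl⟩
  have hgfin : ∀ {z}, z ∉ prepoleSet f → g z ≠ OnePoint.infty := fun hz h =>
    apply_ne_infty_of_notMem_prepoleSet hz ((hfg.apply_eq_infty_iff _).2 h)
  refine ⟨finitePart (g z₀), ?_, coe_finitePart (hgfin (hUE hz₀))⟩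
  have hmap : 𝓝 (finitePart (g z₀)) ≤ map (fun x => finitePart (g x)) (𝓝 z₀) :=
    hg.nhds_le_map hg_nonconst (hgfin (hUE hz₀))
  by_cases hE : (prepoleSet f).Subsingleton
  swap
  · refine hf.mem_fatouSet_of_not_subsingleton hE (hmap ?_)
    rw [mem_map]
    filter_upwards [hUo.mem_nhds hz₀] with z hz
    exact hfg.finitePart_notMem_prepoleSet (hUE hz)
  by_contra hJ
  have hself := hf.isHolomorphicSelfMap hE.isClosed
  set F : ℂ → ℂ := fun z => finitePart (f z) with hF
  have hw : finitePart (g z₀) ∈ (prepoleSet f)ᶜ := hfg.finitePart_notMem_prepoleSet (hUE hz₀)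
  have hX : (prepoleSet f)ᶜ = univ ∨
      ∃ a, (prepoleSet f)ᶜ = {a}ᶜ ∧ Tendsto F (𝓝[≠] a) (Bornology.cobounded ℂ) := by
    rcases hE.eq_empty_or_singleton with h | ⟨a, h⟩
    · left; rw [h, compl_empty]
    · refine Or.inr ⟨a, by rw [h], hf.tendsto_cobounded
        (apply_eq_infty_of_prepoleSet_eq_singleton h) fun z hz =>
          apply_ne_infty_of_notMem_prepoleSet (by rw [h]; exact hz)⟩
  have hφc : ContinuousOn (fun z => ((φ z : ℂ) : Sphere)) U := by
    refine hφ.continuousOn (Frequently.of_forall fun k => ?_)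
    exact (OnePoint.continuous_coe.comp_continuousOn
      ((hself.differentiableOn_iterate (n k)).continuousOn.mono hUE)).congr
        fun z hz => hself.iter_eq (n k) (hUE hz)
  have hprod : ∀ z ∈ U, Tendsto (fun p : ℕ × ℂ => finitePart (iter f (n p.1) p.2))
      (atTop ×ˢ 𝓝 z) (𝓝 (φ z)) := fun z hz =>
    (continuousAt_finitePart (OnePoint.coe_ne_infty (φ z))).tendsto.comp
      (hφ.tendsto_prod_nhds hUo hφc hz)
  have hgprod : ∀ z ∈ U, Tendsto (fun p : ℕ × ℂ => g (finitePart (iter f (n p.1) p.2)))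
      (atTop ×ˢ 𝓝 z) (𝓝 (g (φ z))) := fun z hz =>
    (hg.1.tendsto _).comp (hprod z hz)
  by_cases hφX : φ z₀ ∈ (prepoleSet f)ᶜ
  · refine hself.not_compactlyBoundedAt_of_notMem hX hn hw hJ ?_
    obtain ⟨A, hAn, hAX, hA⟩ := local_compact_nhds
      (hself.isOpen.mem_nhds (hfg.finitePart_notMem_prepoleSet hφX))
    have hev : ∀ᶠ p : ℕ × ℂ in atTop ×ˢ 𝓝 z₀,
        finitePart (g (finitePart (iter f (n p.1) p.2))) ∈ A :=
      ((continuousAt_finitePart (hgfin hφX)).tendsto.comp (hgprod z₀ hz₀)).eventually hAn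
    obtain ⟨P, hP, Q, hQ, hPQ⟩ := eventually_prod_iff.1 hev
    refine ⟨(fun x => finitePart (g x)) '' ({z | Q z} ∩ U),
      hmap (image_mem_map (inter_mem hQ (hUo.mem_nhds hz₀))), A, hA, hAX, ?_⟩
    filter_upwards [hP] with k hk
    rintro _ ⟨z, ⟨hzQ, hzU⟩, rfl⟩
    have h1 := hPQ hk hzQ
    simp only at h1
    rwa [← hfg.iter_finitePart (hUE hzU), hself.iter_eq _
      (hfg.finitePart_notMem_prepoleSet (hUE hzU)), finitePart_coe] at h1
  · rcases hX with hX | ⟨a, hXa, -⟩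
    · exact hφX (hX ▸ mem_univ _)
    have hEa : prepoleSet f = {a} := compl_injective hXa
    have hφa : φ z₀ = a := by rw [hXa] at hφX; simpa using hφX
    have hga : g a = OnePoint.infty :=
      (hfg.apply_eq_infty_iff a).1 (apply_eq_infty_of_prepoleSet_eq_singleton hEa)
    have hφc' : ContinuousOn φ U := fun z hz =>
      (continuousAt_finitePart (OnePoint.coe_ne_infty (φ z))).tendsto.comp (hφc z hz)
    have hunif : TendstoLocallyUniformlyOn (fun k => F^[n k]) φ atTop U :=
      (tendstoLocallyUniformlyOn_of_tendsto_prod_nhds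
        (F := fun k z => finitePart (iter f (n k) z)) hUo hφc' hprod).congr fun k z hz => by
          simp only
          rw [hself.iter_eq _ (hUE hz), finitePart_coe]
    -- Were `φ` nonconstant here, Hurwitz would make some iterate take the value `a` on `U`, but
    -- iterates stay in `X`.
    have hconst : ∀ᶠ z in 𝓝 z₀, φ z = φ z₀ := by
      by_contra hne
      obtain ⟨ε, hε, himg⟩ := exists_ball_subset_image_of_tendstoLocallyUniformlyOn hUo
        (fun k => (hself.differentiableOn_iterate _).mono hUE) hunif hz₀ hne (hUo.mem_nhds hz₀)
      obtain ⟨k, hk⟩ := himg.exists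
      obtain ⟨x, hx, hxa⟩ := hk (mem_ball_self hε)
      exact hφX (hxa ▸ hself.mapsTo_iterate _ (hUE hx))
    rw [hXa] at hself hw
    obtain ⟨_, ⟨z, ⟨hzφ, hzU⟩, rfl⟩, m, hm, hper⟩ := hself.exists_periodic_of_notMem hw hJ
      (hmap (image_mem_map (inter_mem hconst (hUo.mem_nhds hz₀))))
    set p := finitePart (g z) with hp
    have hpX : p ∈ ({a}ᶜ : Set ℂ) := hXa ▸ hfg.finitePart_notMem_prepoleSet (hUE hzU)
    have hlimp : Tendsto (fun k => iter f (n k) p) atTop (𝓝 OnePoint.infty) := by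
      have h1 : Tendsto (fun k => g (finitePart (iter f (n k) z))) atTop (𝓝 (g (φ z))) :=
        (hgprod z hzU).comp (tendsto_id.prodMk tendsto_const_nhds)
      have h2 : φ z = a := hzφ.trans hφa
      rw [h2, hga] at h1
      exact h1.congr fun k => (hfg.iter_finitePart (hUE hzU) (n k)).symm
    -- The finite orbit of the periodic point `p` is closed and misses `∞`, so `f^{n_k} p` cannot
    -- tend to `∞`.
    set T : Set Sphere := (fun i => ((F^[i] p : ℂ) : Sphere)) '' (Finset.range m : Set ℕ) with hT
    have hTfin : T.Finite := (Finset.finite_toSet _).image _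
    have hTinf : OnePoint.infty ∉ T := by
      rintro ⟨i, -, hi⟩
      exact OnePoint.coe_ne_infty _ hi
    obtain ⟨k, hk⟩ := (hlimp.eventually (hTfin.isClosed.isOpen_compl.mem_nhds hTinf)).exists
    refine hk ⟨n k % m, Finset.mem_coe.2 (Finset.mem_range.2 (Nat.mod_lt _ hm)), ?_⟩
    simp only
    rw [hself.iter_eq _ hpX, Function.IsPeriodicPt.iterate_mod_apply hper]
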